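/- Let $p$ be a prime, let $R$ be a finite $p$-group of coclass $r$ (i.e. $|R|=p^{c+r}$, where $c$ is the nilpotency class of $R$), and let $T$ be a free $\mathbb{Z}_p$-module of finite rank $d$ on which $R$ acts $\mathbb{Z}_p$-linearly. Let $T=T_0\ge T_1\ge T_2\ge\cdots$ be the lower $R$-central series, $T_{i+1}=[R,T_i]=\langle gt-t \mid g\in R,\ t\in T_i\rangle$, and assume that $R$ acts uniserially, i.e. $[T_i:T_{i+1}]=p$ whenever $T_i\neq 0$. Then $pT_n\le T_{n+d}$ for all $n\ge 0$; put $A_n=T/T_n$ and let $\mu\colon H^3(R,T_n)\to H^3(R,T_{n+d})$ be induced by $t\mapsto pt$. Let $f_n$ be the exponent of $H^3(R,T_n)$, let $D_n=\{t\in T\mid f_n t\in T_n\}$, and let $K_n$ be the image of $H^2(R,D_n/T_n)\to H^2(R,A_n)$. We say that $H^2(R,A_n)$ decomposes canonically if the map $H^2(R,T)\oplus K_n\to H^2(R,A_n)$, given by the projection $T\to A_n$ and the inclusion of $K_n$, is bijective and the connecting homomorphism $H^2(R,A_n)\to H^3(R,T_n)$ restricts to a bijection $K_n\to H^3(R,T_n)$;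 this gives a canonical isomorphism $H^2(R,A_n)\cong H^2(R,T)\oplus H^3(R,T_n)$. If $H^2(R,A_n)$ and $H^2(R,A_{n+d})$ decompose canonically, let $(\mathrm{id}\oplus\mu)\colon H^2(R,A_n)\to H^2(R,A_{n+d})$ be the map $(\alpha,\beta)\mapsto(\alpha,\mu(\beta))$. For a $2$-cocycle $\gamma\in Z^2(R,A_n)$ let $E(\gamma)$ denote the group extension of $A_n$ by $R$ defined by $\gamma$. Lemma. There is a natural number $m\le 2d\log_p|R|$ such that $H^2(R,A_n)$ decomposes canonically for every $n\ge m$ and such that the following holds. Let $t_0\in T$ be such that $\langle t_0,T_1\rangle=T$, with stabilizer $R_{t_0}$, and put $a(n)=\max\{\exp H^2(R,T),\exp H^3(R,T_n)\}$ and $b(n)=\exp H^1(R_{t_0},T_n)$. Let $v$ be a natural number such that $vd\ge m$ and $p^v\ge b(n)\cdot\max\{a(n),b(n)\}$ for every $n\in\mathbb{N}_0$. Then for every $n\ge vd$ the map $(\mathrm{id}\oplus\mu)$ induces a bijection from the set of isomorphism classes of group extensions of the $R$-module $A_n$ by $R$ of coclass $r$ onto the set of isomorphism classes of group extensions of the $R$-module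 $A_{n+d}$ by $R$ of coclass $r$: if $\gamma\in Z^2(R,A_n)$ is such that $E(\gamma)$ has coclass $r$, and $\gamma_*\in Z^2(R,A_{n+d})$ represents the image of the class of $\gamma$ under $(\mathrm{id}\oplus\mu)$, then $E(\gamma_*)$ has coclass $r$, and the bijection sends the isomorphism class of $E(\gamma)$ to that of $E(\gamma_*)$. -/

import Mathlib

open CategoryTheory

namespace UniserialExt

noncomputable section

section Extensions

/-- The underlying set `A × G` of the group extension of the `G`-module `A` by `G` which is defined
by the 2-cocycle `f`. -/
@[ext]
structure CocycleExt {k G : Type} [CommRing k] [Group G] (A : Rep k G)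
    (f : groupCohomology.cocycles₂ A) where
  fst : A
  snd : G

variable {k G : Type} [CommRing k] [Group G] {A : Rep k G} (f : groupCohomology.cocycles₂ A)

instance : Mul (CocycleExt A f) :=
  ⟨fun x y => ⟨x.fst + A.ρ x.snd y.fst + f (x.snd, y.snd), x.snd * y.snd⟩⟩

instance : One (CocycleExt A f) := ⟨⟨-f (1, 1), 1⟩⟩

instance : Inv (CocycleExt A f) :=
  ⟨fun x => ⟨-A.ρ x.snd⁻¹ x.fst - f (x.snd⁻¹, x.snd) - f (1, 1), x.snd⁻¹⟩⟩

theorem mul_def (x y : CocycleExt A f) :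
    x * y = ⟨x.fst + A.ρ x.snd y.fst + f (x.snd, y.snd), x.snd * y.snd⟩ := rfl

theorem one_def : (1 : CocycleExt A f) = ⟨-f (1, 1), 1⟩ := rfl

theorem inv_def (x : CocycleExt A f) :
    x⁻¹ = ⟨-A.ρ x.snd⁻¹ x.fst - f (x.snd⁻¹, x.snd) - f (1, 1), x.snd⁻¹⟩ := rfl

/-- The extension `E(f)`: multiplication `(a, g) (b, h) = (a + g b + f(g, h), g h)`. -/
instance : Group (CocycleExt A f) :=
  Group.ofLeftAxioms
    (by
      intro x y z
      have h := (groupCohomology.mem_cocycles₂_iff f.1).1 f.2 x.snd y.snd z.snd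
      simp only [mul_def, map_add, map_mul, Module.End.mul_apply, mul_assoc]
      ext
      · change f.1 (x.snd * y.snd, z.snd) + f.1 (x.snd, y.snd) = _ at h
        change x.fst + A.ρ x.snd y.fst + f.1 (x.snd, y.snd) + A.ρ x.snd (A.ρ y.snd z.fst)
            + f.1 (x.snd * y.snd, z.snd) =
          x.fst + (A.ρ x.snd y.fst + A.ρ x.snd (A.ρ y.snd z.fst)
            + A.ρ x.snd (f.1 (y.snd, z.snd))) + f.1 (x.snd, y.snd * z.snd)
        calc _ = x.fst + A.ρ x.snd y.fst + A.ρ x.snd (A.ρ y.snd z.fst)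
              + (f.1 (x.snd * y.snd, z.snd) + f.1 (x.snd, y.snd)) := by abel
          _ = _ := by rw [h]; abel
      · rfl)
    (by
      intro x
      have h := groupCohomology.cocycles₂_map_one_fst f x.snd
      simp only [mul_def, one_def, map_one, Module.End.one_apply, one_mul, h]
      ext
      · change -f (1, 1) + x.fst + f (1, 1) = x.fst
        abel
      · rfl)
    (by
      intro x
      simp only [mul_def, one_def, inv_def, inv_mul_cancel]
      ext
      · change -A.ρ x.snd⁻¹ x.fst - f (x.snd⁻¹, x.snd) - f (1, 1) + A.ρ x.snd⁻¹ x.fst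
          + f (x.snd⁻¹, x.snd) = -f (1, 1)
        abel
      · rfl)

end Extensions

/-- The finite `p`-group `G` has coclass `r`: its order is `p ^ (c + r)` where `c` is its
nilpotency class. -/
def HasCoclass (p : ℕ) (G : Type) [Group G] (r : ℕ) : Prop :=
  Nat.card G = p ^ (Group.nilpotencyClass G + r)

variable {p : ℕ} [Fact p.Prime] {R T : Type} [Group R] [AddCommGroup T] [Module ℤ_[p] T]
  (ρ : Representation ℤ_[p] R T)

/-- `[R, N]`, the submodule generated by all `g n - n` with `g ∈ R`, `n ∈ N`. -/
def commSub (N : Submodule ℤ_[p] T) : Submodule ℤ_[p] T :=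
  Submodule.span ℤ_[p] {x | ∃ g : R, ∃ t ∈ N, x = ρ g t - t}

/-- The lower `R`-central series `T = T₀ ≥ T₁ ≥ T₂ ≥ ⋯`, `Tᵢ₊₁ = [R, Tᵢ]`. -/
def lcs : ℕ → Submodule ℤ_[p] T
  | 0 => ⊤
  | i + 1 => commSub ρ (lcs i)

/-- `R` acts uniserially: `[Tᵢ : Tᵢ₊₁] = p` whenever `Tᵢ ≠ 0`. -/
def IsUniserial : Prop :=
  ∀ i, lcs ρ i ≠ ⊥ → (lcs ρ (i + 1)).toAddSubgroup.relIndex (lcs ρ i).toAddSubgroup = p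

theorem rho_mem_commSub {N : Submodule ℤ_[p] T} (hN : ∀ g, N ≤ N.comap (ρ g)) (g : R) :
    commSub ρ N ≤ (commSub ρ N).comap (ρ g) := by
  refine Submodule.span_le.2 ?_
  rintro _ ⟨h, t, ht, rfl⟩
  refine Submodule.subset_span ⟨g * h * g⁻¹, ρ g t, hN g ht, ?_⟩
  rw [← Module.End.mul_apply, ← map_mul]
  simp

theorem lcs_le_comap : ∀ (n : ℕ) (g : R), lcs ρ n ≤ (lcs ρ n).comap (ρ g)
  | 0, _ => fun _ _ => Submodule.mem_top
  | n + 1, g => rho_mem_commSub ρ (lcs_le_comap n) g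

theorem lcs_succ_le (n : ℕ) : lcs ρ (n + 1) ≤ lcs ρ n := by
  refine Submodule.span_le.2 ?_
  rintro _ ⟨h, t, ht, rfl⟩
  exact Submodule.sub_mem _ (lcs_le_comap ρ n h ht) ht

theorem exists_addMonoidHom_ne_zero' {Q : Type} [AddCommGroup Q] [Module (ZMod p) Q] {q : Q}
    (hq : q ≠ 0) : ∃ φ : Q →+ ZMod p, φ q ≠ 0 := by
  by_contra hcon
  push Not at hcon
  exact hq ((Module.forall_dual_apply_eq_zero_iff (ZMod p) q).1 fun f => hcon f.toAddMonoidHom)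

theorem exists_addMonoidHom_ne_zero {Q : Type} [AddCommGroup Q] (hp : ∀ q : Q, p • q = 0) {q : Q}
    (hq : q ≠ 0) : ∃ φ : Q →+ ZMod p, φ q ≠ 0 :=
  letI := AddCommGroup.zmodModule hp
  exists_addMonoidHom_ne_zero' hq

/-- A finite `p`-group acting on a finite elementary abelian `p`-group `Q` with `[R, Q] = Q` forces
`Q = 0`. -/
theorem subsingleton_of_commSub_eq_top [Finite R] (hR : IsPGroup p R) {Q : Type} [AddCommGroup Q]
    [Module ℤ_[p] Q] [Finite Q] (σ : Representation ℤ_[p] R Q) (hp : ∀ q : Q, p • q = 0)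
    (h : commSub σ ⊤ = ⊤) : Subsingleton Q := by
  by_contra hQ
  rw [not_subsingleton_iff_nontrivial] at hQ
  let _ : MulAction R (Q →+ ZMod p) :=
    { smul := fun g f => f.comp (σ g⁻¹).toAddMonoidHom
      one_smul := fun f => by
        ext q
        change f (σ (1 : R)⁻¹ q) = f q
        simp
      mul_smul := fun g g' f => by
        ext q
        change f (σ (g * g')⁻¹ q) = f (σ g'⁻¹ (σ g⁻¹ q))
        simp }
  have hsm : ∀ (g : R) (f : Q →+ ZMod p) (q : Q), (g • f) q = f (σ g⁻¹ q) := fun _ _ _ => rfl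
  have : Finite (Q →+ ZMod p) := DFunLike.finite _
  obtain ⟨q, hq⟩ := exists_ne (0 : Q)
  have hex : ∃ φ : Q →+ ZMod p, φ q ≠ 0 := exists_addMonoidHom_ne_zero hp hq
  obtain ⟨φ, hφ⟩ := hex
  have hφ0 : φ ≠ 0 := fun h0 => hφ (DFunLike.congr_fun h0 q)
  have hord : addOrderOf φ = p :=
    addOrderOf_eq_prime (by ext x; simp) hφ0
  have hdvd : p ∣ Nat.card (Q →+ ZMod p) := by
    have h1 := addOrderOf_dvd_natCard φ
    rwa [hord] at h1
  have h0 : (0 : Q →+ ZMod p) ∈ MulAction.fixedPoints R (Q →+ ZMod p) := fun g => by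
    ext x
    rw [hsm]
    rfl
  obtain ⟨f, hf, hf0⟩ := hR.exists_fixed_point_of_prime_dvd_card_of_fixed_point _ hdvd h0
  apply hf0
  ext x
  have hx : x ∈ commSub σ ⊤ := by
    rw [h]
    exact Submodule.mem_top
  rw [AddMonoidHom.zero_apply, eq_comm]
  have hgen : ∀ (g : R) (t : Q), f (σ g t - t) = 0 := fun g t => by
    have := DFunLike.congr_fun (hf g⁻¹) t
    rw [hsm, inv_inv] at this
    rw [map_sub, this, sub_self]
  have key : ∀ c : ℤ_[p], f (c • x) = 0 := by
    refine Submodule.span_induction (p := fun y _ => ∀ c : ℤ_[p], f (c • y) = 0)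
      ?_ (fun c => by rw [smul_zero, map_zero]) ?_ ?_ hx
    · rintro _ ⟨g, t, -, rfl⟩ c
      rw [smul_sub, ← map_smul]
      exact hgen g (c • t)
    · intro a b _ _ ha hb c
      rw [smul_add, map_add, ha, hb, add_zero]
    · intro b a _ ha c
      rw [smul_smul]
      exact ha _
  simpa using key 1

/-- `p T`. -/
def pTop (p : ℕ) [Fact p.Prime] (T : Type) [AddCommGroup T] [Module ℤ_[p] T] :
    Submodule ℤ_[p] T :=
  LinearMap.range (LinearMap.lsmul ℤ_[p] T (p : ℤ_[p]))

theorem smul_mem_pTop (t : T) : p • t ∈ pTop p T :=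
  ⟨t, by simp [Nat.cast_smul_eq_nsmul]⟩

theorem index_pTop [Module.Free ℤ_[p] T] [Module.Finite ℤ_[p] T] :
    (pTop p T).toAddSubgroup.index = p ^ Module.finrank ℤ_[p] T := by
  let b := Module.finBasis ℤ_[p] T
  let F : T →+ (Fin (Module.finrank ℤ_[p] T) → ZMod p) :=
    { toFun := fun t i => PadicInt.toZMod (b.repr t i)
      map_zero' := by ext; simp
      map_add' := fun x y => by ext; simp }
  have hF : Function.Surjective F := by
    intro y
    choose z hz using fun i => ZMod.ringHom_surjective (PadicInt.toZMod (p := p)) (y i)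
    refine ⟨b.equivFun.symm z, ?_⟩
    ext i
    change PadicInt.toZMod (b.repr (b.equivFun.symm z) i) = y i
    rw [← b.equivFun_apply, LinearEquiv.apply_symm_apply, hz]
  have hker : F.ker = (pTop p T).toAddSubgroup := by
    ext t
    constructor
    · intro ht
      have h1 : ∀ i, ∃ c : ℤ_[p], b.repr t i = p * c := by
        intro i
        have : PadicInt.toZMod (b.repr t i) = 0 := congrFun (AddMonoidHom.mem_ker.1 ht) i
        have h2 : b.repr t i ∈ RingHom.ker (PadicInt.toZMod (p := p)) := this
        rw [PadicInt.ker_toZMod, PadicInt.maximalIdeal_eq_span_p, Ideal.mem_span_singleton] at h2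
        exact h2
      choose c hc using h1
      refine ⟨b.equivFun.symm c, ?_⟩
      have h3 : (p : ℤ_[p]) • c = b.equivFun t := by
        ext1 i
        rw [b.equivFun_apply, hc i, Pi.smul_apply, smul_eq_mul]
      rw [LinearMap.lsmul_apply, ← map_smul, h3, LinearEquiv.symm_apply_apply]
    · rintro ⟨s, rfl⟩
      rw [AddMonoidHom.mem_ker]
      ext i
      change PadicInt.toZMod (b.repr ((p : ℤ_[p]) • s) i) = 0
      simp
  rw [← hker, AddSubgroup.index_ker, AddMonoidHom.range_eq_top.2 hF]
  simp

theorem index_lcs (hU : IsUniserial ρ) (n : ℕ) (hn : ∀ i < n, lcs ρ i ≠ ⊥) :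
    (lcs ρ n).toAddSubgroup.index = p ^ n := by
  induction n with
  | zero => simp [lcs]
  | succ n ih =>
    rw [← AddSubgroup.relIndex_mul_index (H := (lcs ρ (n + 1)).toAddSubgroup)
      (K := (lcs ρ n).toAddSubgroup) (lcs_succ_le ρ n), hU n (hn n (Nat.lt_succ_self n)),
      ih fun i hi => hn i (hi.trans (Nat.lt_succ_self n)), pow_succ']

theorem lcs_antitone : Antitone (lcs ρ) := antitone_nat_of_succ_le (lcs_succ_le ρ)

theorem pTop_le_comap (g : R) : pTop p T ≤ (pTop p T).comap (ρ g) := by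
  rintro _ ⟨t, rfl⟩
  exact ⟨ρ g t, by simp⟩

theorem commSub_mono {M N : Submodule ℤ_[p] T} (h : M ≤ N) : commSub ρ M ≤ commSub ρ N := by
  refine Submodule.span_mono ?_
  rintro _ ⟨g, t, ht, rfl⟩
  exact ⟨g, t, h ht, rfl⟩

/-- If `p T ≤ N`, `N` is `R`-invariant and `N ≤ [R, N] + p T`, then `N ≤ p T`. -/
theorem le_pTop_of_le [Finite R] [Module.Free ℤ_[p] T] [Module.Finite ℤ_[p] T]
    (hR : IsPGroup p R) (N : Submodule ℤ_[p] T) (hN : ∀ g, N ≤ N.comap (ρ g))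
    (h : N ≤ commSub ρ N ⊔ pTop p T) : N ≤ pTop p T := by
  let σ := ρ.quotient (pTop p T) (pTop_le_comap ρ)
  let W : Submodule ℤ_[p] (T ⧸ pTop p T) := N.map (pTop p T).mkQ
  have hW : ∀ g, W ≤ W.comap (σ g) := by
    rintro g _ ⟨t, ht, rfl⟩
    exact ⟨ρ g t, hN g ht, rfl⟩
  have hfin : Finite (T ⧸ pTop p T) := by
    have h1 : (pTop p T).toAddSubgroup.index ≠ 0 := by
      rw [index_pTop]
      exact pow_ne_zero _ (Fact.out : p.Prime).ne_zero
    have : (pTop p T).toAddSubgroup.FiniteIndex := ⟨h1⟩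
    exact AddSubgroup.finite_quotient_of_finiteIndex (H := (pTop p T).toAddSubgroup)
  have hs : Subsingleton W := by
    refine subsingleton_of_commSub_eq_top hR (σ.subrepresentation W hW) ?_ ?_
    · rintro ⟨_, t, ht, rfl⟩
      apply Subtype.ext
      exact (Submodule.Quotient.mk_eq_zero _).2 (smul_mem_pTop t)
    · rw [eq_top_iff]
      rintro ⟨_, t, ht, rfl⟩ -
      obtain ⟨u, hu, v, hv, rfl⟩ := Submodule.mem_sup.1 (h ht)
      have key : ∀ u ∈ commSub ρ N, ∃ hu : (pTop p T).mkQ u ∈ W,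
          (⟨(pTop p T).mkQ u, hu⟩ : W) ∈ commSub (σ.subrepresentation W hW) ⊤ := by
        intro u hu
        refine Submodule.span_induction (p := fun u _ => ∃ hu : (pTop p T).mkQ u ∈ W,
          (⟨(pTop p T).mkQ u, hu⟩ : W) ∈ commSub (σ.subrepresentation W hW) ⊤) ?_ ?_ ?_ ?_ hu
        · rintro _ ⟨g, s, hs, rfl⟩
          refine ⟨⟨_, N.sub_mem (hN g hs) hs, rfl⟩, Submodule.subset_span
            ⟨g, ⟨_, s, hs, rfl⟩, Submodule.mem_top, ?_⟩⟩
          apply Subtype.ext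
          simp [σ]
        · exact ⟨by simp, by convert Submodule.zero_mem _; simp⟩
        · rintro a b _ _ ⟨ha, ha'⟩ ⟨hb, hb'⟩
          exact ⟨by rw [map_add]; exact W.add_mem ha hb, by
            convert Submodule.add_mem _ ha' hb' using 1; apply Subtype.ext; simp⟩
        · rintro c a _ ⟨ha, ha'⟩
          exact ⟨by rw [map_smul]; exact W.smul_mem c ha, by
            convert Submodule.smul_mem _ c ha' using 1; apply Subtype.ext; simp⟩
      obtain ⟨hu1, hu2⟩ := key u hu
      convert hu2 using 1
      apply Subtype.ext
      have : (pTop p T).mkQ v = 0 := (Submodule.Quotient.mk_eq_zero _).2 hv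
      change (pTop p T).mkQ (u + v) = (pTop p T).mkQ u
      rw [map_add, this, add_zero]
  intro t ht
  have : (⟨(pTop p T).mkQ t, t, ht, rfl⟩ : W) = 0 := Subsingleton.elim _ _
  exact (Submodule.Quotient.mk_eq_zero _).1 (congrArg Subtype.val this)

theorem pTop_le_lcs [Finite R] [Module.Free ℤ_[p] T] [Module.Finite ℤ_[p] T] (hR : IsPGroup p R)
    (hU : IsUniserial ρ) (j : ℕ) (hj : j ≤ Module.finrank ℤ_[p] T) : pTop p T ≤ lcs ρ j := by
  have hpp : p.Prime := Fact.out
  induction j with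
  | zero => exact le_top
  | succ j ih =>
    have ih := ih (by omega)
    have hbot : lcs ρ j ≠ ⊥ := by
      intro h0
      rw [h0, le_bot_iff, pTop, LinearMap.range_eq_bot] at ih
      have : Nontrivial T := Module.nontrivial_of_finrank_pos (R := ℤ_[p]) (by omega)
      obtain ⟨t, ht⟩ := exists_ne (0 : T)
      have h1 := LinearMap.congr_fun ih t
      simp only [LinearMap.lsmul_apply, LinearMap.zero_apply, smul_eq_zero] at h1
      rcases h1 with h1 | h1
      · exact hpp.ne_zero (by exact_mod_cast h1)
      · exact ht h1
    have hprime : (lcs ρ (j + 1)).toAddSubgroup.relIndex (lcs ρ j).toAddSubgroup = p := hU j hbot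
    set N' : Submodule ℤ_[p] T := lcs ρ (j + 1) ⊔ pTop p T with hN'
    have h1 : lcs ρ (j + 1) ≤ N' := le_sup_left
    have h2 : N' ≤ lcs ρ j := sup_le (lcs_succ_le ρ j) ih
    have hmul := AddSubgroup.relIndex_mul_relIndex (lcs ρ (j + 1)).toAddSubgroup
      N'.toAddSubgroup (lcs ρ j).toAddSubgroup h1 h2
    rw [hprime] at hmul
    rcases (Nat.dvd_prime hpp).1 ⟨_, hmul.symm⟩ with h3 | h3
    · rw [AddSubgroup.relIndex_eq_one] at h3
      exact le_sup_right.trans h3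
    · exfalso
      rw [h3] at hmul
      have h4 : N'.toAddSubgroup.relIndex (lcs ρ j).toAddSubgroup = 1 :=
        Nat.eq_of_mul_eq_mul_left hpp.pos (by rw [hmul, mul_one])
      rw [AddSubgroup.relIndex_eq_one] at h4
      have h5 : lcs ρ j ≤ pTop p T := le_pTop_of_le ρ hR _ (lcs_le_comap ρ j) h4
      have h6 : lcs ρ j = pTop p T := le_antisymm h5 ih
      have h7 := index_lcs ρ hU j fun i hi h0 =>
        hbot (le_bot_iff.1 ((lcs_antitone ρ hi.le).trans h0.le))
      rw [h6, index_pTop] at h7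
      have := Nat.pow_right_injective hpp.two_le h7
      omega

/-- `p Tₙ ≤ Tₙ₊d`, where `d` is the rank of `T`. -/
theorem smul_mem_lcs [Finite R] [Module.Free ℤ_[p] T] [Module.Finite ℤ_[p] T] (hR : IsPGroup p R)
    (hU : IsUniserial ρ) (n : ℕ) :
    ∀ t ∈ lcs ρ n, (p : ℤ_[p]) • t ∈ lcs ρ (n + Module.finrank ℤ_[p] T) := by
  induction n with
  | zero =>
    intro t _
    rw [zero_add]
    exact pTop_le_lcs ρ hR hU _ le_rfl ⟨t, rfl⟩
  | succ n ih =>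
    intro t ht
    rw [Nat.add_right_comm]
    refine Submodule.span_induction
      (p := fun t _ => (p : ℤ_[p]) • t ∈ lcs ρ (n + Module.finrank ℤ_[p] T + 1))
      ?_ (by simp) ?_ ?_ ht
    · rintro _ ⟨g, s, hs, rfl⟩
      exact Submodule.subset_span ⟨g, _, ih s hs, by rw [map_smul, smul_sub]⟩
    · intro a b _ _ ha hb
      rw [smul_add]
      exact Submodule.add_mem _ ha hb
    · intro c a _ ha
      rw [smul_comm]
      exact Submodule.smul_mem _ c ha

/-- `T` as a `ℤ_p R`-module. -/
abbrev latticeRep : Rep ℤ_[p] R := Rep.of ρ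

/-- The term `Tₙ` of the lower `R`-central series as a `ℤ_p R`-module. -/
abbrev termRep (n : ℕ) : Rep ℤ_[p] R := (latticeRep ρ).subrepresentation (lcs ρ n) (lcs_le_comap ρ n)

/-- `Aₙ = T / Tₙ` as a `ℤ_p R`-module. -/
abbrev quotRep (n : ℕ) : Rep ℤ_[p] R := (latticeRep ρ).quotient (lcs ρ n) (lcs_le_comap ρ n)

/-- `0 → Tₙ → T → Aₙ → 0`. -/
def shortCx (n : ℕ) : ShortComplex (Rep ℤ_[p] R) where
  X₁ := termRep ρ n
  X₂ := latticeRep ρ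
  X₃ := quotRep ρ n
  f := (latticeRep ρ).subtype (lcs ρ n) (lcs_le_comap ρ n)
  g := (latticeRep ρ).mkQ (lcs ρ n) (lcs_le_comap ρ n)
  zero := by
    ext x
    exact (Submodule.Quotient.mk_eq_zero _).2 x.2

theorem shortCx_shortExact (n : ℕ) : (shortCx ρ n).ShortExact where
  exact := (forget₂ (Rep ℤ_[p] R) (ModuleCat ℤ_[p])).reflects_exact_of_faithful _ <|
    (ShortComplex.moduleCat_exact_iff _).2
    fun x hx => ⟨(⟨x, (Submodule.Quotient.mk_eq_zero _).1 hx⟩ : lcs ρ n), rfl⟩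
  mono_f := (Rep.mono_iff_injective _).2 fun _ _ h => Subtype.ext h
  epi_g := (Rep.epi_iff_surjective _).2 <| Submodule.mkQ_surjective _

/-- The map `H²(R, T) → H²(R, Aₙ)` induced by the projection `T → Aₙ`. -/
def projH2 (n : ℕ) :
    groupCohomology (latticeRep ρ) 2 →ₗ[ℤ_[p]] groupCohomology (quotRep ρ n) 2 :=
  ((groupCohomology.functor ℤ_[p] R 2).map (shortCx ρ n).g).hom

/-- The connecting homomorphism `H²(R, Aₙ) → H³(R, Tₙ)`. -/
def connH2 (n : ℕ) :
    groupCohomology (quotRep ρ n) 2 →ₗ[ℤ_[p]] groupCohomology (termRep ρ n) 3 :=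
  (groupCohomology.δ (shortCx_shortExact ρ n) 2 3 rfl).hom

/-- `D / Tₙ ≤ Aₙ`, where `D = {t ∈ T | f t ∈ Tₙ}` and `f` is the exponent of `H³(R, Tₙ)`. -/
def divSub (n : ℕ) : Submodule ℤ_[p] (quotRep ρ n) :=
  ((lcs ρ n).comap (LinearMap.lsmul ℤ_[p] T
    ((AddMonoid.exponent (groupCohomology (termRep ρ n) 3) : ℕ) : ℤ_[p]))).map (lcs ρ n).mkQ

theorem divSub_le_comap (n : ℕ) (g : R) :
    divSub ρ n ≤ (divSub ρ n).comap ((quotRep ρ n).ρ g) := by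
  rintro _ ⟨t, ht, rfl⟩
  refine ⟨ρ g t, ?_, rfl⟩
  have := lcs_le_comap ρ n g ht
  simpa using this

/-- The canonical complement `Kₙ`: the image of `H²(R, D / Tₙ)` in `H²(R, Aₙ)`. -/
def canonCompl (n : ℕ) : Submodule ℤ_[p] (groupCohomology (quotRep ρ n) 2) :=
  LinearMap.range ((groupCohomology.functor ℤ_[p] R 2).map
    ((quotRep ρ n).subtype (divSub ρ n) (divSub_le_comap ρ n))).hom

/-- `H²(R, Aₙ)` decomposes canonically as `H²(R, T) ⊕ H³(R, Tₙ)`: it is the direct sum of the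
isomorphic image of `H²(R, T)` and of `Kₙ`, and the connecting homomorphism maps `Kₙ`
isomorphically onto `H³(R, Tₙ)`. -/
structure CanonDecomp (n : ℕ) : Prop where
  sum_bijective : Function.Bijective ((projH2 ρ n).coprod (canonCompl ρ n).subtype)
  conn_bijective : Function.Bijective ((connH2 ρ n).domRestrict (canonCompl ρ n))

/-- The canonical isomorphism `H²(R, T) ⊕ H³(R, Tₙ) ≅ H²(R, Aₙ)`. -/
def canonEquiv {n : ℕ} (h : CanonDecomp ρ n) :
    (groupCohomology (latticeRep ρ) 2 × groupCohomology (termRep ρ n) 3) ≃ₗ[ℤ_[p]]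
      groupCohomology (quotRep ρ n) 2 :=
  ((LinearEquiv.refl ℤ_[p] _).prodCongr (LinearEquiv.ofBijective _ h.conn_bijective).symm).trans
    (LinearEquiv.ofBijective _ h.sum_bijective)

section

variable [Finite R] [Module.Free ℤ_[p] T] [Module.Finite ℤ_[p] T] (hR : IsPGroup p R)
  (hU : IsUniserial ρ)

/-- The map `Tₙ → Tₙ₊d`, `t ↦ p t`, where `d` is the rank of `T`. -/
def mulP (n : ℕ) : termRep ρ n ⟶ termRep ρ (n + Module.finrank ℤ_[p] T) :=
  Rep.ofHom
    ⟨(LinearMap.lsmul ℤ_[p] T (p : ℤ_[p])).restrict (smul_mem_lcs ρ hR hU n), fun g => by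
      ext t
      change (p : ℤ_[p]) • ρ g t = ρ g ((p : ℤ_[p]) • (t : T))
      rw [map_smul]⟩

/-- The map `μ : H³(R, Tₙ) → H³(R, Tₙ₊d)` induced by multiplication by `p`. -/
def mu (n : ℕ) : groupCohomology (termRep ρ n) 3 →ₗ[ℤ_[p]]
    groupCohomology (termRep ρ (n + Module.finrank ℤ_[p] T)) 3 :=
  ((groupCohomology.functor ℤ_[p] R 3).map (mulP ρ hR hU n)).hom

/-- The map `id ⊕ μ : H²(R, Aₙ) → H²(R, Aₙ₊d)`. -/
def idMu {n : ℕ} (h : CanonDecomp ρ n) (h' : CanonDecomp ρ (n + Module.finrank ℤ_[p] T)) :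
    groupCohomology (quotRep ρ n) 2 →ₗ[ℤ_[p]]
      groupCohomology (quotRep ρ (n + Module.finrank ℤ_[p] T)) 2 :=
  (canonEquiv ρ h').toLinearMap ∘ₗ (LinearMap.id.prodMap (mu ρ hR hU n)) ∘ₗ
    (canonEquiv ρ h).symm.toLinearMap

end

/-- The stabilizer `R_t` of `t`. -/
def stab (t : T) : Subgroup R where
  carrier := {g | ρ g t = t}
  one_mem' := by simp
  mul_mem' := fun {g h} hg hh => by
    change ρ (g * h) t = t
    rw [map_mul, Module.End.mul_apply, show ρ h t = t from hh, show ρ g t = t from hg]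
  inv_mem' := fun {g} hg => by
    change ρ g⁻¹ t = t
    conv_lhs => rw [← show ρ g t = t from hg]
    simp

/-- `a(n) = max {exp H²(R, T), exp H³(R, Tₙ)}`. -/
def expA (n : ℕ) : ℕ :=
  max (AddMonoid.exponent (groupCohomology (latticeRep ρ) 2))
    (AddMonoid.exponent (groupCohomology (termRep ρ n) 3))

/-- `b(n) = exp H¹(R_t, Tₙ)`. -/
def expB (t : T) (n : ℕ) : ℕ :=
  AddMonoid.exponent
    (groupCohomology (Rep.of ((termRep ρ n).ρ.comp (stab ρ t).subtype)) 1)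

/-- The 2-cocycles `γ ∈ Z²(R, Aₙ)` whose group extension `E(γ)` has coclass `r`. -/
def CoclassCocycle (n r : ℕ) : Type :=
  {γ : groupCohomology.cocycles₂ (quotRep ρ n) // HasCoclass p (CocycleExt (quotRep ρ n) γ) r}

/-- Isomorphism of the groups `E(γ)` and `E(γ')`. -/
instance isoSetoid (n r : ℕ) : Setoid (CoclassCocycle ρ n r) where
  r γ γ' := Nonempty (CocycleExt (quotRep ρ n) γ.1 ≃* CocycleExt (quotRep ρ n) γ'.1)
  iseqv :=
    { refl := fun _ => ⟨MulEquiv.refl _⟩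
      symm := fun ⟨e⟩ => ⟨e.symm⟩
      trans := fun ⟨e⟩ ⟨e'⟩ => ⟨e.trans e'⟩ }

/-- The isomorphism classes of group extensions of `Aₙ` by `R` of coclass `r`. -/
def ExtClass (n r : ℕ) : Type := Quotient (isoSetoid ρ n r)

/-- The isomorphism class of `E(γ)`. -/
def ExtClass.mk {n r : ℕ} (γ : groupCohomology.cocycles₂ (quotRep ρ n))
    (hγ : HasCoclass p (CocycleExt (quotRep ρ n) γ) r) : ExtClass ρ n r :=
  Quotient.mk (isoSetoid ρ n r) ⟨γ, hγ⟩

end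

end UniserialExt

/-! Write `|R| = p ^ e`, `d = rank T`, `c` for the class of `R`, and take `m = 2ed`. Two facts drive
everything: `p ^ e` kills the cohomology of `R` in positive degrees (`card_smul_groupCohomology`),
and `Tₙ₊d = p Tₙ` (`exists_smul_of_mem_lcs`), so that `Tₙ ≤ p^(2e) T` for `n ≥ 2ed`. Let `D = {t | p
^ e t ∈ Tₙ}`; then `D ≤ p ^ e T`.

An equivariant map into a lattice whose values are divisible by `p ^ e` is `p ^ e` times an
equivariant map, hence zero on cohomology. Applied to `Tₙ → T`, `Tₙ → D` and `D → T`, this splits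
`H²(R, Aₙ)`, with the image of `H²(R, D / Tₙ)` as complement (`canonDecomp`). That image is `Kₙ`,
although `D` is defined with `p ^ e` in place of the exponent `fₙ`. On cocycles, `id ⊕ μ` becomes `α
+ β ↦ α + p β` with `β` valued in `D / Tₙ` (`corresponds_iff`).

Coclass: by uniseriality, `E(γ)` has coclass `r` exactly when the `c`-th term of its lower central
series (counted from 0) is all of `Aₙ`, and this can be tested modulo `T₁` (`hasCoclass_iff`). As `D
≤ T₁`, neither `β` nor `p β` affects the test.

Isomorphism: in coclass `r` the subgroup `Aₙ` is thus a term of the lower central series, so an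
isomorphism is a compatible pair `(σ, τ)` which matches the cocycle classes. Averaging a linear lift
of `τ` over `R` and dividing by `p ^ e` gives `τ = τ' + θ`, with `τ'` a `σ`-equivariant endomorphism
of `T` and `θ` valued in `D / Tₙ` (`exists_liftedPair`). The pair `τ' + p θ` then does on `Aₙ₊d`
what `τ' + θ` does on `Aₙ` (`LiftedPair.corresponds_push`). Every pair on `Aₙ₊d` arises in this way,
since `p` maps `D / Tₙ` onto its analogue for `n + d`. Hence isomorphism classes match in both
directions. -/

namespace UniserialExt

noncomputable section

/-! ### Cohomology of a finite group is killed by the group order; long exact sequences. -/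

section Cohomology

variable {k G : Type} [CommRing k] [Group G]

theorem contractNth_last_snoc {n : ℕ} (g : Fin n → G) (x : G) :
    Fin.contractNth (Fin.last n) (· * ·) (Fin.snoc g x : Fin (n + 1) → G) = g := by
  ext i
  have hi : (i : ℕ) < (Fin.last n : ℕ) := i.2
  rw [Fin.contractNth_apply_of_lt _ _ _ _ hi, Fin.snoc_castSucc]

/-- The appended entry is changed only by the contraction that touches it, and then by a left
translation, which disappears on summing over the group. -/
theorem contractNth_castSucc_snoc {n : ℕ} (j : Fin (n + 1)) (g : Fin (n + 1) → G) (x : G) :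
    Fin.contractNth j.castSucc (· * ·) (Fin.snoc g x : Fin (n + 2) → G) =
      Fin.snoc (Fin.contractNth j (· * ·) g)
        (if j = Fin.last n then g (Fin.last n) * x else x) := by
  ext i
  refine Fin.lastCases ?_ (fun i => ?_) i
  · rw [Fin.snoc_last]
    by_cases hj : j = Fin.last n
    · rw [if_pos hj, Fin.contractNth_apply_of_eq _ _ _ _ (by simp [hj]), Fin.snoc_castSucc]
      simp
    · have : (j : ℕ) < n := by
        have := Fin.val_lt_last hj
        simpa using this
      rw [if_neg hj, Fin.contractNth_apply_of_gt _ _ _ _ (by simpa using this)]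
      simp
  · rw [Fin.snoc_castSucc]
    rcases lt_trichotomy (i : ℕ) (j : ℕ) with h | h | h
    · rw [Fin.contractNth_apply_of_lt _ _ _ _ (by simpa using h), Fin.snoc_castSucc,
        Fin.contractNth_apply_of_lt _ _ _ _ h]
    · rw [Fin.contractNth_apply_of_eq _ _ _ _ (by simpa using h), Fin.snoc_castSucc,
        Fin.contractNth_apply_of_eq _ _ _ _ h, ← Fin.castSucc_succ, Fin.snoc_castSucc]
    · rw [Fin.contractNth_apply_of_gt _ _ _ _ (by simpa using h),
        Fin.contractNth_apply_of_gt _ _ _ _ h, ← Fin.castSucc_succ, Fin.snoc_castSucc]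

/-- Summing a cochain over its last argument. -/
def sumLast [Fintype G] {A : Rep.{0} k G} {n : ℕ} (f : (Fin (n + 1) → G) → A) :
    (Fin n → G) → A :=
  fun g => ∑ x : G, f (Fin.snoc g x)

theorem sum_contractNth_castSucc [Fintype G] {A : Rep.{0} k G} {n : ℕ} (f : (Fin (n + 1) → G) → A)
    (j : Fin (n + 1)) (g : Fin (n + 1) → G) :
    ∑ x : G, f (Fin.contractNth j.castSucc (· * ·) (Fin.snoc g x : Fin (n + 2) → G)) =
      sumLast f (Fin.contractNth j (· * ·) g) := by
  simp only [contractNth_castSucc_snoc, sumLast]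
  split_ifs
  · exact Equiv.sum_comp (Equiv.mulLeft (g (Fin.last n)))
      fun x => f (Fin.snoc (Fin.contractNth j (· * ·) g) x)
  · rfl

/-- Sum the cocycle identity for `(g, x)` over `x`. The term that drops the last argument
contributes `|G|` times `f g` up to sign; the others assemble to the coboundary of `sumLast f`. -/
theorem d_sumLast [Fintype G] {A : Rep.{0} k G} {n : ℕ} (f : (Fin (n + 1) → G) → A)
    (hf : inhomogeneousCochains.d A (n + 1) f = 0) :
    inhomogeneousCochains.d A n ((-1 : k) ^ (n + 1) • sumLast f) = Nat.card G • f := by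
  rw [map_smul]
  funext g
  have h : ∀ x : G, (inhomogeneousCochains.d A (n + 1) f) (Fin.snoc g x) = 0 := fun x => by
    rw [hf]; rfl
  have hs := Finset.sum_eq_zero fun x (_ : x ∈ Finset.univ) => h x
  have htail : ∀ x : G, (fun i : Fin (n + 1) => (Fin.snoc g x : Fin (n + 2) → G) i.succ) =
      Fin.snoc (fun i : Fin n => g i.succ) x := fun x => by
    ext i
    refine Fin.lastCases ?_ (fun i => ?_) i
    · simp
    · rw [Fin.snoc_castSucc, Fin.succ_castSucc, Fin.snoc_castSucc]
  have hzero : ∀ x : G, (Fin.snoc g x : Fin (n + 2) → G) 0 = g 0 := fun x => by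
    rw [← Fin.castSucc_zero, Fin.snoc_castSucc]
  simp only [inhomogeneousCochains.d_hom_apply, Finset.sum_add_distrib, htail, hzero,
    Fin.sum_univ_castSucc (n := n + 1), contractNth_last_snoc] at hs
  rw [Finset.sum_comm] at hs
  simp only [← Finset.smul_sum, sum_contractNth_castSucc, ← map_sum, Finset.sum_const,
    Finset.card_univ, Fin.val_castSucc] at hs
  change (-1 : k) ^ (n + 1) • (inhomogeneousCochains.d A n (sumLast f)) g = Nat.card G • f g
  simp only [inhomogeneousCochains.d_hom_apply]
  rw [← Nat.card_eq_fintype_card] at hs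
  change A.ρ (g 0) (sumLast f fun i => g i.succ) + _ = 0 at hs
  rw [← add_assoc] at hs
  rw [eq_neg_of_add_eq_zero_left hs]
  simp only [Fin.val_last, smul_neg, smul_smul, ← pow_add]
  rw [← neg_smul, show n + 1 + (n + 1 + 1) = 2 * (n + 1) + 1 by ring, pow_succ, pow_mul]
  simp

theorem card_smul_groupCohomology [Finite G] (A : Rep.{0} k G) (n : ℕ)
    (x : groupCohomology A (n + 1)) : Nat.card G • x = 0 := by
  have := Fintype.ofFinite G
  induction x using groupCohomology_induction_on with
  | h z =>
    let f : (Fin (n + 1) → G) → A := groupCohomology.iCocycles A (n + 1) z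
    have hf : inhomogeneousCochains.d A (n + 1) f = 0 := by
      have h := congr($((groupCohomology.inhomogeneousCochains A).iCycles_d (n + 1) (n + 2)) z)
      rw [groupCohomology.inhomogeneousCochains.d_def] at h
      exact h
    have hz : Nat.card G • z = groupCohomology.toCocycles A n (n + 1)
        ((-1 : k) ^ (n + 1) • sumLast f) := by
      apply (ModuleCat.mono_iff_injective (groupCohomology.iCocycles A (n + 1))).1 inferInstance
      rw [map_nsmul]
      have h := congr($((groupCohomology.inhomogeneousCochains A).toCycles_i n (n + 1))
        ((-1 : k) ^ (n + 1) • sumLast f))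
      rw [groupCohomology.inhomogeneousCochains.d_def] at h
      exact ((h.trans (d_sumLast f hf))).symm
    rw [← map_nsmul, hz]
    exact congr($((groupCohomology.inhomogeneousCochains A).toCycles_comp_homologyπ n (n + 1))
        ((-1 : k) ^ (n + 1) • sumLast f))

instance (n : ℕ) : (groupCohomology.functor k G n).Additive :=
  inferInstanceAs (groupCohomology.cochainsFunctor k G ⋙
    HomologicalComplex.homologyFunctor (ModuleCat k) _ n).Additive

/-- The map `Hⁿ(G, A) → Hⁿ(G, B)` induced by a morphism `A ⟶ B`. -/
abbrev mapH {A B : Rep.{0} k G} (φ : A ⟶ B) (n : ℕ) :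
    groupCohomology A n →ₗ[k] groupCohomology B n :=
  ((groupCohomology.functor k G n).map φ).hom

/-- The functor `Hⁿ` is additive, so `φ = m ψ` induces `m` times a map, and `m` already kills the
source. -/
theorem mapH_eq_zero_of_nsmul {A B : Rep.{0} k G} (n m : ℕ) (φ ψ : A ⟶ B)
    (h : ∀ x, φ.hom x = m • ψ.hom x) (hm : ∀ x : groupCohomology A n, m • x = 0)
    (x : groupCohomology A n) : mapH φ n x = 0 := by
  have hφ : φ = m • ψ := by
    ext x
    exact h x
  have h1 : (groupCohomology.functor k G n).map φ = m • (groupCohomology.functor k G n).map ψ := by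
    rw [hφ]
    exact (groupCohomology.functor k G n).map_nsmul
  rw [mapH, h1]
  change m • mapH ψ n x = 0
  rw [← map_nsmul, hm, map_zero]

theorem mapH_comp {A B C : Rep.{0} k G} (φ : A ⟶ B) (ψ : B ⟶ C) (n : ℕ)
    (x : groupCohomology A n) : mapH (φ ≫ ψ) n x = mapH ψ n (mapH φ n x) :=
  congr($((groupCohomology.functor k G n).map_comp φ ψ) x)

theorem mapH_id {A : Rep.{0} k G} (n : ℕ) (x : groupCohomology A n) : mapH (𝟙 A) n x = x :=
  congr($((groupCohomology.functor k G n).map_id A) x)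

section LongExact

variable {X Y : ShortComplex (Rep.{0} k G)} (hX : X.ShortExact) (hY : Y.ShortExact)

theorem δ_naturality_apply (F : X ⟶ Y) (i j : ℕ) (hij : i + 1 = j) (x : groupCohomology X.X₃ i) :
    mapH F.τ₁ j (groupCohomology.δ hX i j hij x) =
      groupCohomology.δ hY i j hij (mapH F.τ₃ i x) :=
  congr($(groupCohomology.δ_naturality hX hY F i j hij) x)

theorem exists_δ_eq {i j : ℕ} (hij : i + 1 = j) (x : groupCohomology X.X₁ j)
    (hx : mapH X.f j x = 0) : ∃ y, groupCohomology.δ hX i j hij y = x :=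
  (ShortComplex.moduleCat_exact_iff _).1 (groupCohomology.mapShortComplex₁_exact hX hij) x hx

include hX in
theorem exists_mapH_f_eq (i : ℕ) (x : groupCohomology X.X₂ i) (hx : mapH X.g i x = 0) :
    ∃ y, mapH X.f i y = x :=
  (ShortComplex.moduleCat_exact_iff _).1 (groupCohomology.mapShortComplex₂_exact hX i) x hx

theorem exists_mapH_g_eq {i j : ℕ} (hij : i + 1 = j) (x : groupCohomology X.X₃ i)
    (hx : groupCohomology.δ hX i j hij x = 0) : ∃ y, mapH X.g i y = x :=
  (ShortComplex.moduleCat_exact_iff _).1 (groupCohomology.mapShortComplex₃_exact hX hij) x hx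

theorem δ_mapH_g {i j : ℕ} (hij : i + 1 = j) (x : groupCohomology X.X₂ i) :
    groupCohomology.δ hX i j hij (mapH X.g i x) = 0 :=
  congr($((groupCohomology.mapShortComplex₃ hX hij).zero) x)

end LongExact

end Cohomology
end

noncomputable section

section Division

variable {k G : Type} [CommRing k] [Group G]

/-- Quotients by `m` are unique in the absence of `m`-torsion, so pointwise division is
automatically linear and equivariant. -/
theorem exists_nsmul_hom {A B : Rep.{0} k G} (φ : A ⟶ B) (m : ℕ)
    (hB : ∀ b : B, m • b = 0 → b = 0) (h : ∀ x, ∃ b : B, φ.hom x = m • b) :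
    ∃ ψ : A ⟶ B, ∀ x, φ.hom x = m • ψ.hom x := by
  choose f hf using h
  have hinj : ∀ a b : B, m • a = m • b → a = b := fun a b hab =>
    sub_eq_zero.1 (hB _ (by rw [smul_sub, hab, sub_self]))
  refine ⟨Rep.ofHom ⟨⟨⟨f, fun x y => hinj _ _ ?_⟩, fun c x => hinj _ _ ?_⟩, fun g => ?_⟩, hf⟩
  · rw [← hf, map_add, hf, hf, smul_add]
  · change m • f (c • x) = m • c • f x
    rw [← hf, map_smul, hf, smul_comm]
  · ext x
    refine hinj _ _ ?_
    change m • f (A.ρ g x) = m • B.ρ g (f x)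
    rw [← hf, Rep.hom_comm_apply, hf, map_nsmul]

end Division

variable {p : ℕ} [Fact p.Prime] {R T : Type} [Group R] [AddCommGroup T] [Module ℤ_[p] T]
  (ρ : Representation ℤ_[p] R T)


theorem lattice_smul_eq_zero (p : ℕ) [Fact p.Prime] {T : Type} [AddCommGroup T] [Module ℤ_[p] T]
    [Module.Free ℤ_[p] T] (m : ℕ) (hm : m ≠ 0) (t : T) (h : m • t = 0) : t = 0 := by
  rw [← Nat.cast_smul_eq_nsmul ℤ_[p], smul_eq_zero] at h
  exact h.resolve_left (by exact_mod_cast hm)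

/-! ### The lower central series of the lattice is periodic up to multiplication by `p`. -/

section Series

variable [Finite R] [Module.Free ℤ_[p] T] [Module.Finite ℤ_[p] T]

theorem lcs_ne_bot_of_lt (hR : IsPGroup p R) (hU : IsUniserial ρ) {i : ℕ}
    (hi : i < Module.finrank ℤ_[p] T) : lcs ρ i ≠ ⊥ := by
  intro h0
  have h := pTop_le_lcs ρ hR hU i hi.le
  rw [h0, le_bot_iff, pTop, LinearMap.range_eq_bot] at h
  have : Nontrivial T := Module.nontrivial_of_finrank_pos (R := ℤ_[p]) (by omega)
  obtain ⟨t, ht⟩ := exists_ne (0 : T)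
  refine ht (lattice_smul_eq_zero p p (Fact.out : p.Prime).ne_zero t ?_)
  rw [← Nat.cast_smul_eq_nsmul ℤ_[p]]
  exact LinearMap.congr_fun h t

/-- One submodule contains the other, and both have index `p ^ d` in `T`. -/
theorem lcs_finrank (hR : IsPGroup p R) (hU : IsUniserial ρ) :
    lcs ρ (Module.finrank ℤ_[p] T) = pTop p T := by
  refine le_antisymm ?_ (pTop_le_lcs ρ hR hU _ le_rfl)
  have hle := pTop_le_lcs ρ hR hU _ le_rfl
  have h1 := AddSubgroup.relIndex_mul_index (H := (pTop p T).toAddSubgroup)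
    (K := (lcs ρ (Module.finrank ℤ_[p] T)).toAddSubgroup) hle
  rw [index_pTop, index_lcs ρ hU _ fun i hi => lcs_ne_bot_of_lt ρ hR hU hi] at h1
  have h2 := Nat.eq_of_mul_eq_mul_right (pow_pos (Fact.out : p.Prime).pos _)
    (h1.trans (one_mul _).symm)
  exact AddSubgroup.relIndex_eq_one.1 h2

/-- `Tₙ₊d = p Tₙ`. -/
theorem exists_smul_of_mem_lcs (hR : IsPGroup p R) (hU : IsUniserial ρ) (n : ℕ) :
    ∀ t ∈ lcs ρ (n + Module.finrank ℤ_[p] T), ∃ s ∈ lcs ρ n, t = p • s := by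
  induction n with
  | zero =>
    intro t ht
    rw [zero_add, lcs_finrank ρ hR hU] at ht
    obtain ⟨s, rfl⟩ := ht
    exact ⟨s, Submodule.mem_top, by simp [Nat.cast_smul_eq_nsmul]⟩
  | succ n ih =>
    intro t ht
    rw [Nat.add_right_comm] at ht
    refine Submodule.span_induction (p := fun t _ => ∃ s ∈ lcs ρ (n + 1), t = p • s)
      ?_ ⟨0, zero_mem _, by simp⟩ ?_ ?_ ht
    · rintro _ ⟨g, u, hu, rfl⟩
      obtain ⟨s, hs, rfl⟩ := ih u hu
      exact ⟨ρ g s - s, Submodule.subset_span ⟨g, s, hs, rfl⟩, by rw [smul_sub, map_nsmul]⟩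
    · rintro _ _ _ _ ⟨a, ha, rfl⟩ ⟨b, hb, rfl⟩
      exact ⟨a + b, add_mem ha hb, by rw [smul_add]⟩
    · rintro c _ _ ⟨a, ha, rfl⟩
      exact ⟨c • a, Submodule.smul_mem _ c ha, by rw [smul_comm]⟩

theorem nsmul_mem_lcs (hR : IsPGroup p R) (hU : IsUniserial ρ) {n : ℕ} {t : T}
    (ht : t ∈ lcs ρ n) : p • t ∈ lcs ρ (n + Module.finrank ℤ_[p] T) := by
  have := smul_mem_lcs ρ hR hU n t ht
  rwa [Nat.cast_smul_eq_nsmul] at this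

theorem nsmul_mem_lcs_iff (hR : IsPGroup p R) (hU : IsUniserial ρ) {n : ℕ} {t : T} :
    p • t ∈ lcs ρ (n + Module.finrank ℤ_[p] T) ↔ t ∈ lcs ρ n := by
  refine ⟨fun h => ?_, nsmul_mem_lcs ρ hR hU⟩
  obtain ⟨s, hs, h⟩ := exists_smul_of_mem_lcs ρ hR hU n _ h
  rw [← sub_eq_zero, ← smul_sub] at h
  rwa [sub_eq_zero.1 (lattice_smul_eq_zero p p (Fact.out : p.Prime).ne_zero _ h)]

theorem exists_pow_smul_of_mem_lcs (hR : IsPGroup p R) (hU : IsUniserial ρ) (j : ℕ) {n : ℕ}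
    (hn : j * Module.finrank ℤ_[p] T ≤ n) {t : T} (ht : t ∈ lcs ρ n) :
    ∃ s, t = p ^ j • s := by
  induction j generalizing n t with
  | zero => exact ⟨t, by simp⟩
  | succ j ih =>
    rw [add_mul, one_mul] at hn
    obtain ⟨s, hs, rfl⟩ := exists_smul_of_mem_lcs ρ hR hU (n - Module.finrank ℤ_[p] T) t
      (by rwa [Nat.sub_add_cancel (by omega)])
    obtain ⟨u, rfl⟩ := ih (by omega) hs
    exact ⟨u, by rw [smul_smul, ← pow_succ']⟩

end Series

/-! ### A complement of `H²(R, T)` from invariant submodules between `Tₙ` and `T`. -/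

section Complement

/-- `0 → Tₙ → N → N / Tₙ → 0` for an `R`-invariant submodule `N` of `T` which contains `Tₙ`. -/
def subCx (n : ℕ) (N : Submodule ℤ_[p] T) (hN : ∀ g, N ≤ N.comap (ρ g)) (hle : lcs ρ n ≤ N)
    (hN' : ∀ g, N.map (lcs ρ n).mkQ ≤ (N.map (lcs ρ n).mkQ).comap ((quotRep ρ n).ρ g)) :
    ShortComplex (Rep ℤ_[p] R) where
  X₁ := termRep ρ n
  X₂ := (latticeRep ρ).subrepresentation N hN
  X₃ := (quotRep ρ n).subrepresentation (N.map (lcs ρ n).mkQ) hN'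
  f := Rep.ofHom ⟨Submodule.inclusion hle, fun _ => rfl⟩
  g := Rep.ofHom ⟨(lcs ρ n).mkQ.restrict fun _ ht => Submodule.mem_map_of_mem ht, fun _ => rfl⟩
  zero := by
    ext x
    exact (Submodule.Quotient.mk_eq_zero _).2 x.2

variable {ρ} {n : ℕ} {N : Submodule ℤ_[p] T} {hN : ∀ g, N ≤ N.comap (ρ g)} {hle : lcs ρ n ≤ N}
  {hN' : ∀ g, N.map (lcs ρ n).mkQ ≤ (N.map (lcs ρ n).mkQ).comap ((quotRep ρ n).ρ g)}

theorem subCx_shortExact : (subCx ρ n N hN hle hN').ShortExact where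
  exact := (forget₂ (Rep ℤ_[p] R) (ModuleCat ℤ_[p])).reflects_exact_of_faithful _ <|
    (ShortComplex.moduleCat_exact_iff _).2
    fun x hx => ⟨(⟨x.1, (Submodule.Quotient.mk_eq_zero _).1 (congrArg Subtype.val hx)⟩ : lcs ρ n),
      rfl⟩
  mono_f := (Rep.mono_iff_injective _).2 fun _ _ h =>
    Subtype.ext (congrArg (fun y : N => (y : T)) h)
  epi_g := (Rep.epi_iff_surjective _).2 <| by
    rintro ⟨_, t, ht, rfl⟩
    exact ⟨⟨t, ht⟩, rfl⟩

/-- The inclusion of `0 → Tₙ → N → N / Tₙ → 0` in `0 → Tₙ → T → Aₙ → 0`. -/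
def subCxHom : subCx ρ n N hN hle hN' ⟶ shortCx ρ n where
  τ₁ := 𝟙 _
  τ₂ := (latticeRep ρ).subtype N hN
  τ₃ := (quotRep ρ n).subtype (N.map (lcs ρ n).mkQ) hN'
  comm₁₂ := rfl
  comm₂₃ := rfl

variable (ρ n) in
/-- The image of `H²(R, N / Tₙ)` in `H²(R, Aₙ)`. -/
def imageH2 (N : Submodule ℤ_[p] T)
    (hN' : ∀ g, N.map (lcs ρ n).mkQ ≤ (N.map (lcs ρ n).mkQ).comap ((quotRep ρ n).ρ g)) :
    Submodule ℤ_[p] (groupCohomology (quotRep ρ n) 2) :=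
  LinearMap.range (mapH ((quotRep ρ n).subtype (N.map (lcs ρ n).mkQ) hN') 2)

include hle in
theorem connH2_subtype (hN : ∀ g, N ≤ N.comap (ρ g))
    (z : groupCohomology ((quotRep ρ n).subrepresentation (N.map (lcs ρ n).mkQ) hN') 2) :
    connH2 ρ n (mapH
      ((quotRep ρ n).subtype (N.map (lcs ρ n).mkQ) hN') 2 z) =
    groupCohomology.δ (subCx_shortExact (hN := hN) (hle := hle) (hN' := hN')) 2 3 rfl z := by
  have h := δ_naturality_apply (subCx_shortExact (hN := hN) (hle := hle) (hN' := hN'))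
    (shortCx_shortExact ρ n) subCxHom 2 3 rfl z
  refine Eq.trans h.symm ?_
  exact mapH_id (A := termRep ρ n) 3 _

theorem connH2_projH2 (x : groupCohomology (latticeRep ρ) 2) :
    connH2 ρ n (projH2 ρ n x) = 0 :=
  δ_mapH_g (shortCx_shortExact ρ n) rfl x

theorem exists_projH2_eq {x : groupCohomology (quotRep ρ n) 2} (hx : connH2 ρ n x = 0) :
    ∃ y, projH2 ρ n y = x :=
  exists_mapH_g_eq (shortCx_shortExact ρ n) rfl x hx

variable [Finite R] [Module.Free ℤ_[p] T] {e : ℕ}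

theorem pow_smul_groupCohomology (he : Nat.card R = p ^ e) (A : Rep ℤ_[p] R) (i : ℕ)
    (x : groupCohomology A (i + 1)) : p ^ e • x = 0 :=
  he ▸ card_smul_groupCohomology A i x

theorem map_eq_zero_of_range_le (he : Nat.card R = p ^ e) {A : Rep ℤ_[p] R}
    (φ : A ⟶ latticeRep ρ) (hφ : ∀ x, ∃ s : T, φ.hom x = p ^ e • s) (i : ℕ)
    (x : groupCohomology A (i + 1)) :
    mapH φ (i + 1) x = 0 := by
  obtain ⟨ψ, hψ⟩ := exists_nsmul_hom φ (p ^ e)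
    (fun b hb => lattice_smul_eq_zero p _ (pow_ne_zero _ (Fact.out : p.Prime).ne_zero) b hb)
    hφ
  exact mapH_eq_zero_of_nsmul _ _ φ ψ hψ (pow_smul_groupCohomology he _ _) x

/-- A class from `H²(R, N / Tₙ)` killed by the connecting homomorphism lifts to `H²(R, N)`, and
`H²(R, N) → H²(R, T)` is zero because `N ≤ p ^ e T`. -/
theorem eq_zero_of_mem_imageH2 (he : Nat.card R = p ^ e) (hN : ∀ g, N ≤ N.comap (ρ g))
    (hle : lcs ρ n ≤ N) (hNe : ∀ t ∈ N, ∃ s : T, t = p ^ e • s)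
    {y : groupCohomology (quotRep ρ n) 2} (hy : y ∈ imageH2 ρ n N hN') (h : connH2 ρ n y = 0) :
    y = 0 := by
  obtain ⟨z, rfl⟩ := hy
  obtain ⟨w, rfl⟩ := exists_mapH_g_eq (subCx_shortExact (hN := hN) (hle := hle) (hN' := hN'))
    rfl z ((connH2_subtype (hle := hle) hN z).symm.trans h)
  refine (mapH_comp (subCx ρ n N hN hle hN').g _ 2 w).symm.trans ?_
  refine (mapH_comp ((latticeRep ρ).subtype N hN) (shortCx ρ n).g 2 w).trans ?_
  exact (congrArg _ (map_eq_zero_of_range_le he ((latticeRep ρ).subtype N hN)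
    (fun x : N => hNe x.1 x.2) 1 w)).trans (map_zero _)

omit [Finite R] in
-- The inclusion `Tₙ → N` is divisible by `m`, so `H³(R, Tₙ) → H³(R, N)` is zero and the connecting
-- homomorphism from `H²(R, N / Tₙ)` is onto.
theorem exists_mem_imageH2 {m : ℕ} (hm : m ≠ 0) (hN : ∀ g, N ≤ N.comap (ρ g))
    (hle : lcs ρ n ≤ N) (hNm : ∀ t ∈ lcs ρ n, ∃ s ∈ N, t = m • s)
    (hH : ∀ x : groupCohomology (termRep ρ n) 3, m • x = 0)
    (y : groupCohomology (termRep ρ n) 3) : ∃ x ∈ imageH2 ρ n N hN', connH2 ρ n x = y := by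
  obtain ⟨ψ, hψ⟩ := exists_nsmul_hom (subCx ρ n N hN hle hN').f m
    (fun b hb => Subtype.ext (lattice_smul_eq_zero p m hm b.1 (congrArg Subtype.val hb)))
    (fun x => by
      obtain ⟨s, hs, h⟩ := hNm x.1 x.2
      exact ⟨⟨s, hs⟩, Subtype.ext h⟩)
  obtain ⟨z, rfl⟩ := exists_δ_eq (subCx_shortExact (hN := hN) (hle := hle) (hN' := hN'))
    rfl y (mapH_eq_zero_of_nsmul _ _ _ ψ hψ hH y)
  exact ⟨_, ⟨z, rfl⟩, connH2_subtype (hle := hle) hN z⟩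

theorem projH2_injective (he : Nat.card R = p ^ e)
    (hn : ∀ t ∈ lcs ρ n, ∃ s : T, t = p ^ e • s) : Function.Injective (projH2 ρ n) := by
  rw [injective_iff_map_eq_zero]
  intro x hx
  obtain ⟨y, rfl⟩ := exists_mapH_f_eq (shortCx_shortExact ρ n) 2 x hx
  exact map_eq_zero_of_range_le he (shortCx ρ n).f (fun x : lcs ρ n => hn x.1 x.2) 1 y

end Complement

end

noncomputable section

/-! ### Explicit 2-cocycles and their classes. -/

section Cocycles

variable {k G : Type} [CommRing k] [Group G] {A B : Rep.{0} k G}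

/-- The map `Z²(G, A) → Z²(G, B)` induced by a morphism `A ⟶ B`. -/
def mapZ2 (φ : A ⟶ B) (f : groupCohomology.cocycles₂ A) : groupCohomology.cocycles₂ B :=
  groupCohomology.mapCocycles₂ (A := A) (MonoidHom.id G) φ f

theorem mapH_H2π (φ : A ⟶ B) (f : groupCohomology.cocycles₂ A) :
    mapH φ 2 (groupCohomology.H2π A f) = groupCohomology.H2π B (mapZ2 φ f) :=
  congr($(groupCohomology.H2π_comp_map (A := A) (MonoidHom.id G) φ) f)

theorem exists_H2π_eq (x : groupCohomology A 2) : ∃ f, groupCohomology.H2π A f = x :=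
  (ModuleCat.epi_iff_surjective (groupCohomology.H2π A)).1 inferInstance x

/-- In this subtraction-free form the coboundary condition is the one under which `(a, g) ↦ (a + c
g, g)` is multiplicative from `E(f)` to `E(f')`. -/
theorem H2π_eq_iff (f f' : groupCohomology.cocycles₂ A) :
    groupCohomology.H2π A f = groupCohomology.H2π A f' ↔
      ∃ c : G → A, ∀ g h, f (g, h) + c (g * h) = c g + A.ρ g (c h) + f' (g, h) := by
  rw [groupCohomology.H2π_eq_iff]
  constructor
  · rintro ⟨c, hc⟩
    refine ⟨c, fun g h => ?_⟩
    have := congrFun hc (g, h)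
    change A.ρ g (c h) - c (g * h) + c g = f (g, h) - f' (g, h) at this
    rw [← sub_add_cancel (f (g, h)) (f' (g, h)), ← this]
    abel
  · rintro ⟨c, hc⟩
    refine ⟨c, funext fun x => ?_⟩
    have := hc x.1 x.2
    change A.ρ x.1 (c x.2) - c (x.1 * x.2) + c x.1 = f x - f' x
    change f x + c (x.1 * x.2) = c x.1 + A.ρ x.1 (c x.2) + f' x at this
    rw [eq_sub_of_add_eq this]
    abel

theorem mapZ2_add (φ : A ⟶ B)
    (f f' : groupCohomology.cocycles₂ A) : mapZ2 φ (f + f') = mapZ2 φ f + mapZ2 φ f' :=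
  groupCohomology.cocycles₂_ext fun _ _ => map_add φ.hom _ _

theorem H2π_mapZ2_congr (φ : A ⟶ B)
    {f f' : groupCohomology.cocycles₂ A}
    (h : groupCohomology.H2π A f = groupCohomology.H2π A f') :
    groupCohomology.H2π B (mapZ2 φ f) = groupCohomology.H2π B (mapZ2 φ f') := by
  rw [← mapH_H2π, ← mapH_H2π, h]

theorem mem_range_mapH_subtype (W : Submodule k A) (hW : ∀ g, W ≤ W.comap (A.ρ g))
    {x : groupCohomology A 2} :
    x ∈ LinearMap.range (mapH (A.subtype W hW) 2) ↔
      ∃ b : groupCohomology.cocycles₂ A, (∀ y, b y ∈ W) ∧ groupCohomology.H2π A b = x := by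
  constructor
  · rintro ⟨z, rfl⟩
    obtain ⟨f, rfl⟩ := exists_H2π_eq z
    exact ⟨mapZ2 (A.subtype W hW) f, fun y => (f y).2, (mapH_H2π _ f).symm⟩
  · rintro ⟨b, hb, rfl⟩
    refine ⟨groupCohomology.H2π _ (⟨fun y => ⟨b y, hb y⟩, ?_⟩ :
      groupCohomology.cocycles₂ (A.subrepresentation W hW)), mapH_H2π _ _⟩
    rw [groupCohomology.mem_cocycles₂_iff]
    intro g h j
    exact Subtype.ext ((groupCohomology.mem_cocycles₂_iff b.1).1 b.2 g h j)

end Cocycles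

variable {p : ℕ} [Fact p.Prime] {R T : Type} [Group R] [AddCommGroup T] [Module ℤ_[p] T]
  (ρ : Representation ℤ_[p] R T)

/-! ### The canonical decomposition when `Tₙ ≤ p^(2e) T`. -/

section Division

/-- `{t ∈ T | f t ∈ Tₙ}`. -/
def divLat (f n : ℕ) : Submodule ℤ_[p] T :=
  (lcs ρ n).comap (LinearMap.lsmul ℤ_[p] T (f : ℤ_[p]))

variable {ρ}

theorem mem_divLat {f n : ℕ} {t : T} : t ∈ divLat ρ f n ↔ f • t ∈ lcs ρ n := by
  rw [← Nat.cast_smul_eq_nsmul ℤ_[p]]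
  rfl

theorem divLat_le_comap {f n : ℕ} (g : R) : divLat ρ f n ≤ (divLat ρ f n).comap (ρ g) := by
  intro t ht
  rw [Submodule.mem_comap, mem_divLat, ← map_nsmul]
  exact lcs_le_comap ρ n g (mem_divLat.1 ht)

theorem lcs_le_divLat (f n : ℕ) : lcs ρ n ≤ divLat ρ f n := fun _ ht =>
  Submodule.smul_mem _ _ ht

theorem map_divLat_le_comap (f n : ℕ) (g : R) :
    (divLat ρ f n).map (lcs ρ n).mkQ ≤
      ((divLat ρ f n).map (lcs ρ n).mkQ).comap ((quotRep ρ n).ρ g) := by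
  rintro _ ⟨t, ht, rfl⟩
  exact ⟨ρ g t, divLat_le_comap g ht, rfl⟩

theorem divLat_mono {f f' : ℕ} (h : f ∣ f') (n : ℕ) : divLat ρ f n ≤ divLat ρ f' n := by
  obtain ⟨c, rfl⟩ := h
  intro t ht
  rw [mem_divLat] at *
  rw [mul_comm, mul_smul]
  exact nsmul_mem ht c

end Division

variable {ρ} {n e : ℕ} [Finite R] [Module.Free ℤ_[p] T]

omit [Finite R] in
theorem exists_eq_pow_smul_of_mem_divLat (hn : ∀ t ∈ lcs ρ n, ∃ s, t = p ^ (2 * e) • s) {t : T}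
    (ht : t ∈ divLat ρ (p ^ e) n) : ∃ s, t = p ^ e • s := by
  obtain ⟨s, hs⟩ := hn _ (mem_divLat.1 ht)
  refine ⟨s, ?_⟩
  rw [two_mul, pow_add, mul_smul, ← sub_eq_zero, ← smul_sub] at hs
  exact sub_eq_zero.1
    (lattice_smul_eq_zero p _ (pow_ne_zero _ (Fact.out : p.Prime).ne_zero) _ hs)

/-- The subgroup of `H²(R, Aₙ)` of the classes of cocycles whose values are killed by `p ^ e`. -/
abbrev torsionH2 (ρ : Representation ℤ_[p] R T) (e n : ℕ) :
    Submodule ℤ_[p] (groupCohomology (quotRep ρ n) 2) :=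
  imageH2 ρ n (divLat ρ (p ^ e) n) (map_divLat_le_comap (p ^ e) n)

omit [Module.Free ℤ_[p] T] in
theorem exponent_H3_dvd (he : Nat.card R = p ^ e) :
    AddMonoid.exponent (groupCohomology (termRep ρ n) 3) ∣ p ^ e :=
  AddMonoid.exponent_dvd_of_forall_nsmul_eq_zero (pow_smul_groupCohomology he _ 2)

omit [Module.Free ℤ_[p] T] in
theorem canonCompl_le_torsionH2 (he : Nat.card R = p ^ e) :
    canonCompl ρ n ≤ torsionH2 ρ e n := by
  intro x hx
  obtain ⟨b, hb, rfl⟩ := (mem_range_mapH_subtype _ _).1 hx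
  exact (mem_range_mapH_subtype _ _).2
    ⟨b, fun y => Submodule.map_mono (divLat_mono (exponent_H3_dvd he) n) (hb y), rfl⟩

theorem eq_zero_of_mem_torsionH2 (he : Nat.card R = p ^ e)
    (hn : ∀ t ∈ lcs ρ n, ∃ s, t = p ^ (2 * e) • s) {x : groupCohomology (quotRep ρ n) 2}
    (hx : x ∈ torsionH2 ρ e n) (h : connH2 ρ n x = 0) : x = 0 :=
  eq_zero_of_mem_imageH2 he divLat_le_comap (lcs_le_divLat _ n)
    (fun _ => exists_eq_pow_smul_of_mem_divLat hn) hx h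

theorem exists_mem_canonCompl (he : Nat.card R = p ^ e)
    (hn : ∀ t ∈ lcs ρ n, ∃ s, t = p ^ (2 * e) • s) (y : groupCohomology (termRep ρ n) 3) :
    ∃ x ∈ canonCompl ρ n, connH2 ρ n x = y := by
  have hdvd := exponent_H3_dvd (ρ := ρ) (n := n) he
  refine exists_mem_imageH2 (ne_zero_of_dvd_ne_zero
    (pow_ne_zero _ (Fact.out : p.Prime).ne_zero) hdvd) divLat_le_comap (lcs_le_divLat _ n) ?_
    AddMonoid.exponent_nsmul_eq_zero y
  intro t ht
  obtain ⟨s, rfl⟩ := hn t ht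
  obtain ⟨c, hc⟩ := hdvd.trans (pow_dvd_pow p (show e ≤ 2 * e by omega))
  rw [hc, mul_smul] at ht
  exact ⟨c • s, mem_divLat.2 ht, by rw [hc, mul_smul]⟩

/-- The smaller group `Kₙ` already maps onto `H³(R, Tₙ)`, and the larger one meets the kernel
trivially, so they agree. This replaces the exponent `fₙ`, which varies with `n`, by the fixed
number `p ^ e`. -/
theorem torsionH2_le_canonCompl (he : Nat.card R = p ^ e)
    (hn : ∀ t ∈ lcs ρ n, ∃ s, t = p ^ (2 * e) • s) : torsionH2 ρ e n ≤ canonCompl ρ n := by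
  intro x hx
  obtain ⟨y, hy, hxy⟩ := exists_mem_canonCompl he hn (connH2 ρ n x)
  have h := eq_zero_of_mem_torsionH2 he hn
    ((torsionH2 ρ e n).sub_mem hx (canonCompl_le_torsionH2 he hy)) (by rw [map_sub, hxy, sub_self])
  rwa [sub_eq_zero.1 h]

theorem canonDecomp (he : Nat.card R = p ^ e)
    (hn : ∀ t ∈ lcs ρ n, ∃ s, t = p ^ (2 * e) • s) : CanonDecomp ρ n where
  sum_bijective := by
    constructor
    · rw [injective_iff_map_eq_zero]
      rintro ⟨α, κ, hκ⟩ h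
      change projH2 ρ n α + κ = 0 at h
      have h1 := congrArg (connH2 ρ n) h
      rw [map_add, connH2_projH2, zero_add, map_zero] at h1
      have h2 : κ = 0 := eq_zero_of_mem_torsionH2 he hn (canonCompl_le_torsionH2 he hκ) h1
      subst h2
      rw [add_zero] at h
      have h3 : α = 0 := by
        refine (injective_iff_map_eq_zero _).1 (projH2_injective he fun t ht => ?_) α h
        obtain ⟨s, rfl⟩ := hn t ht
        exact ⟨p ^ e • s, by rw [smul_smul, ← pow_add, two_mul]⟩
      rw [h3]
      rfl
    · intro x
      obtain ⟨y, hy, hxy⟩ := exists_mem_canonCompl he hn (connH2 ρ n x)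
      obtain ⟨z, hz⟩ := exists_projH2_eq (ρ := ρ) (n := n) (x := x - y)
        (by rw [map_sub, hxy, sub_self])
      refine ⟨(z, ⟨y, hy⟩), ?_⟩
      change projH2 ρ n z + y = x
      rw [hz, sub_add_cancel]
  conn_bijective := by
    constructor
    · rw [injective_iff_map_eq_zero]
      rintro ⟨κ, hκ⟩ h
      exact Subtype.ext (eq_zero_of_mem_torsionH2 he hn (canonCompl_le_torsionH2 he hκ) h)
    · intro y
      obtain ⟨x, hx, rfl⟩ := exists_mem_canonCompl he hn y
      exact ⟨⟨x, hx⟩, rfl⟩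

omit [Finite R] [Module.Free ℤ_[p] T] in
theorem canonEquiv_apply (h : CanonDecomp ρ n) (α : groupCohomology (latticeRep ρ) 2)
    {κ : groupCohomology (quotRep ρ n) 2} (hκ : κ ∈ canonCompl ρ n) :
    canonEquiv ρ h (α, connH2 ρ n κ) = projH2 ρ n α + κ := by
  have h1 : (LinearEquiv.ofBijective _ h.conn_bijective).symm (connH2 ρ n κ) = ⟨κ, hκ⟩ := by
    rw [LinearEquiv.symm_apply_eq]
    rfl
  change projH2 ρ n α + ((LinearEquiv.ofBijective _ h.conn_bijective).symm (connH2 ρ n κ)).1 = _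
  rw [h1]

end

/-! ### Multiplication by `p` from `Aₙ` to `Aₙ₊d`, and `id ⊕ μ` on cocycles. -/

noncomputable section

variable {p : ℕ} [Fact p.Prime] {R T : Type} [Group R] [AddCommGroup T] [Module ℤ_[p] T]
  {ρ : Representation ℤ_[p] R T} [Finite R] [Module.Free ℤ_[p] T] [Module.Finite ℤ_[p] T]

/-- The projection `T → Aₙ`. -/
abbrev projHom (ρ : Representation ℤ_[p] R T) (n : ℕ) : latticeRep ρ ⟶ quotRep ρ n :=
  (latticeRep ρ).mkQ (lcs ρ n) (lcs_le_comap ρ n)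

/-- The map `Aₙ → Aₙ₊d` induced by `t ↦ p t`. -/
def quotMulP (hR : IsPGroup p R) (hU : IsUniserial ρ) (n : ℕ) :
    quotRep ρ n ⟶ quotRep ρ (n + Module.finrank ℤ_[p] T) :=
  Rep.ofHom
    ⟨Submodule.mapQ _ _ (LinearMap.lsmul ℤ_[p] T (p : ℤ_[p])) (smul_mem_lcs ρ hR hU n),
      fun g => by
        ext t
        change (lcs ρ (n + Module.finrank ℤ_[p] T)).mkQ ((p : ℤ_[p]) • ρ g t) =
          (lcs ρ (n + Module.finrank ℤ_[p] T)).mkQ (ρ g ((p : ℤ_[p]) • t))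
        rw [map_smul (ρ g)]⟩

variable {hR : IsPGroup p R} {hU : IsUniserial ρ} {n : ℕ}

theorem quotMulP_mkQ (t : T) : (quotMulP hR hU n).hom ((lcs ρ n).mkQ t) =
    (lcs ρ (n + Module.finrank ℤ_[p] T)).mkQ (p • t) := by
  rw [← Nat.cast_smul_eq_nsmul ℤ_[p]]
  rfl

theorem quotMulP_injective : Function.Injective (quotMulP hR hU n).hom := by
  rw [injective_iff_map_eq_zero]
  intro x hx
  obtain ⟨t, rfl⟩ := (lcs ρ n).mkQ_surjective x
  rw [quotMulP_mkQ] at hx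
  exact (Submodule.Quotient.mk_eq_zero _).2
    ((nsmul_mem_lcs_iff ρ hR hU).1 ((Submodule.Quotient.mk_eq_zero _).1 hx))

/-- Multiplication by `p` from `0 → Tₙ → T → Aₙ → 0` to `0 → Tₙ₊d → T → Aₙ₊d → 0`. -/
def shortCxMulP (hR : IsPGroup p R) (hU : IsUniserial ρ) (n : ℕ) :
    shortCx ρ n ⟶ shortCx ρ (n + Module.finrank ℤ_[p] T) where
  τ₁ := mulP ρ hR hU n
  τ₂ := Rep.ofHom ⟨LinearMap.lsmul ℤ_[p] T (p : ℤ_[p]), fun g => by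
    ext t
    exact (map_smul (ρ g) (p : ℤ_[p]) t).symm⟩
  τ₃ := quotMulP hR hU n
  comm₁₂ := rfl
  comm₂₃ := rfl

theorem connH2_quotMulP (x : groupCohomology (quotRep ρ n) 2) :
    connH2 ρ _ (mapH (quotMulP hR hU n) 2 x) = mu ρ hR hU n (connH2 ρ n x) :=
  (δ_naturality_apply (shortCx_shortExact ρ n) (shortCx_shortExact ρ _) (shortCxMulP hR hU n)
    2 3 rfl x).symm

variable {e : ℕ}

theorem quotMulP_mem {x : quotRep ρ n} (hx : x ∈ (divLat ρ (p ^ e) n).map (lcs ρ n).mkQ) :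
    (quotMulP hR hU n).hom x ∈ (divLat ρ (p ^ e) (n + Module.finrank ℤ_[p] T)).map
      (lcs ρ (n + Module.finrank ℤ_[p] T)).mkQ := by
  obtain ⟨t, ht, rfl⟩ := hx
  rw [quotMulP_mkQ]
  refine Submodule.mem_map_of_mem (mem_divLat.2 ?_)
  rw [smul_comm]
  exact nsmul_mem_lcs ρ hR hU (mem_divLat.1 ht)

/-- If `p ^ e t ∈ Tₙ₊d = p Tₙ`, then `p ^ e t = p u` with `u ∈ Tₙ ≤ p ^ e T`; cancelling `p ^ e`
shows that `t` is divisible by `p`. -/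
theorem exists_quotMulP_eq (hn : 2 * e * Module.finrank ℤ_[p] T ≤ n)
    {x : quotRep ρ (n + Module.finrank ℤ_[p] T)}
    (hx : x ∈ (divLat ρ (p ^ e) (n + Module.finrank ℤ_[p] T)).map
      (lcs ρ (n + Module.finrank ℤ_[p] T)).mkQ) :
    ∃ y ∈ (divLat ρ (p ^ e) n).map (lcs ρ n).mkQ, (quotMulP hR hU n).hom y = x := by
  obtain ⟨t, ht, rfl⟩ := hx
  have hp : p ≠ 0 := (Fact.out : p.Prime).ne_zero
  obtain ⟨u, hu, h⟩ := exists_smul_of_mem_lcs ρ hR hU n _ (mem_divLat.1 ht)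
  have hle : e * Module.finrank ℤ_[p] T ≤ n :=
    le_trans (Nat.mul_le_mul_right _ (by omega)) hn
  obtain ⟨w, rfl⟩ := exists_pow_smul_of_mem_lcs ρ hR hU e hle hu
  have htw : t = p • w := by
    rw [smul_comm, ← sub_eq_zero, ← smul_sub] at h
    exact sub_eq_zero.1 (lattice_smul_eq_zero p _ (pow_ne_zero _ hp) _ h)
  subst htw
  exact ⟨(lcs ρ n).mkQ w, Submodule.mem_map_of_mem (mem_divLat.2 hu), quotMulP_mkQ w⟩

/-- `γ` and `γ'` represent `α + β` and `α + p β`, where `α` is in `H²(R, T)` and `β` is represented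
by a cocycle whose values are killed by `p ^ e`. -/
def Corresponds (hR : IsPGroup p R) (hU : IsUniserial ρ) (e : ℕ) {n : ℕ}
    (γ : groupCohomology.cocycles₂ (quotRep ρ n))
    (γ' : groupCohomology.cocycles₂ (quotRep ρ (n + Module.finrank ℤ_[p] T))) : Prop :=
  ∃ (a : groupCohomology.cocycles₂ (latticeRep ρ)) (b : groupCohomology.cocycles₂ (quotRep ρ n)),
    (∀ y, b y ∈ (divLat ρ (p ^ e) n).map (lcs ρ n).mkQ) ∧
    groupCohomology.H2π _ γ = groupCohomology.H2π _ (mapZ2 (projHom ρ n) a + b) ∧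
    groupCohomology.H2π _ γ' = groupCohomology.H2π _ (mapZ2 (projHom ρ _) a +
      mapZ2 (quotMulP hR hU n) b)

theorem lcs_le_pow_smul (hR : IsPGroup p R) (hU : IsUniserial ρ)
    (hn : 2 * e * Module.finrank ℤ_[p] T ≤ n) : ∀ t ∈ lcs ρ n, ∃ s, t = p ^ (2 * e) • s :=
  fun _ ht => exists_pow_smul_of_mem_lcs ρ hR hU _ hn ht

variable (he : Nat.card R = p ^ e)

include he in
theorem exists_decomposition (hR : IsPGroup p R) (hU : IsUniserial ρ)
    (hn : 2 * e * Module.finrank ℤ_[p] T ≤ n) (γ : groupCohomology.cocycles₂ (quotRep ρ n)) :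
    ∃ (a : groupCohomology.cocycles₂ (latticeRep ρ))
      (b : groupCohomology.cocycles₂ (quotRep ρ n)),
    (∀ y, b y ∈ (divLat ρ (p ^ e) n).map (lcs ρ n).mkQ) ∧
    groupCohomology.H2π _ γ = groupCohomology.H2π _ (mapZ2 (projHom ρ n) a + b) := by
  obtain ⟨⟨α, κ, hκ⟩, h⟩ := (canonDecomp he (lcs_le_pow_smul hR hU hn)).sum_bijective.2
    (groupCohomology.H2π _ γ)
  obtain ⟨a, rfl⟩ := exists_H2π_eq α
  obtain ⟨b, hb, rfl⟩ := (mem_range_mapH_subtype _ _).1 (canonCompl_le_torsionH2 he hκ)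
  refine ⟨a, b, hb, ?_⟩
  rw [← h, map_add, ← mapH_H2π]
  rfl

include he in
theorem exists_corresponds_right (hR : IsPGroup p R) (hU : IsUniserial ρ)
    (hn : 2 * e * Module.finrank ℤ_[p] T ≤ n) (γ : groupCohomology.cocycles₂ (quotRep ρ n)) :
    ∃ γ', Corresponds hR hU e γ γ' := by
  obtain ⟨a, b, hb, h⟩ := exists_decomposition he hR hU hn γ
  exact ⟨_, a, b, hb, h, rfl⟩

include he in
-- The torsion part of `γ'` is divided by `p` value by value; injectivity of `Aₙ → Aₙ₊d` makes the
-- quotient a cocycle.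
theorem exists_corresponds_left (hR : IsPGroup p R) (hU : IsUniserial ρ)
    (hn : 2 * e * Module.finrank ℤ_[p] T ≤ n)
    (γ' : groupCohomology.cocycles₂ (quotRep ρ (n + Module.finrank ℤ_[p] T))) :
    ∃ γ, Corresponds hR hU e γ γ' := by
  obtain ⟨a, b', hb', h⟩ := exists_decomposition he hR hU (hn.trans (Nat.le_add_right _ _)) γ'
  choose b hb hbb' using fun y => exists_quotMulP_eq (hR := hR) (hU := hU) hn (hb' y)
  have hbc : b ∈ groupCohomology.cocycles₂ (quotRep ρ n) := by
    rw [groupCohomology.mem_cocycles₂_iff]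
    intro g h j
    apply quotMulP_injective (hR := hR) (hU := hU)
    rw [map_add, map_add, hbb', hbb', hbb', Rep.hom_comm_apply, hbb']
    exact (groupCohomology.mem_cocycles₂_iff b'.1).1 b'.2 g h j
  refine ⟨mapZ2 (projHom ρ n) a + ⟨b, hbc⟩, a, ⟨b, hbc⟩, hb, rfl, ?_⟩
  have hb2 : mapZ2 (quotMulP hR hU n) ⟨b, hbc⟩ = b' :=
    groupCohomology.cocycles₂_ext fun g h => hbb' (g, h)
  rw [hb2, h]

include he in
-- The classes of `b` and `p b` lie in the canonical complements, and the connecting homomorphisms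
-- turn multiplication by `p` on coefficients into `μ`.
theorem idMu_eq_of_corresponds (hn : 2 * e * Module.finrank ℤ_[p] T ≤ n)
    (h : CanonDecomp ρ n) (h' : CanonDecomp ρ (n + Module.finrank ℤ_[p] T))
    {γ : groupCohomology.cocycles₂ (quotRep ρ n)}
    {γ' : groupCohomology.cocycles₂ (quotRep ρ (n + Module.finrank ℤ_[p] T))}
    (hγ : Corresponds hR hU e γ γ') :
    idMu ρ hR hU h h' (groupCohomology.H2π _ γ) = groupCohomology.H2π _ γ' := by
  obtain ⟨a, b, hb, h1, h2⟩ := hγ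
  have hκ : groupCohomology.H2π _ b ∈ canonCompl ρ n :=
    torsionH2_le_canonCompl he (lcs_le_pow_smul hR hU hn)
      ((mem_range_mapH_subtype _ _).2 ⟨b, hb, rfl⟩)
  have hκ' : groupCohomology.H2π _ (mapZ2 (quotMulP hR hU n) b) ∈
      canonCompl ρ (n + Module.finrank ℤ_[p] T) :=
    torsionH2_le_canonCompl he (lcs_le_pow_smul hR hU (hn.trans (Nat.le_add_right _ _)))
      ((mem_range_mapH_subtype _ _).2 ⟨_, fun y => quotMulP_mem (hR := hR) (hU := hU) (hb y), rfl⟩)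
  have h3 := canonEquiv_apply h (groupCohomology.H2π _ a) hκ
  have h4 := canonEquiv_apply h' (groupCohomology.H2π _ a) hκ'
  have h5 : ∀ m, projH2 ρ m (groupCohomology.H2π _ a) =
    groupCohomology.H2π _ (mapZ2 (projHom ρ m) a) := fun m => mapH_H2π (projHom ρ m) a
  rw [h5, ← map_add] at h3 h4
  rw [h1, h2]
  refine Eq.trans ?_ h4
  rw [← mapH_H2π, connH2_quotMulP]
  have h6 := (LinearEquiv.symm_apply_eq _).2 h3.symm
  exact congrArg (fun z => canonEquiv ρ h' (z.1, mu ρ hR hU n z.2)) h6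

include he in
theorem corresponds_iff (hn : 2 * e * Module.finrank ℤ_[p] T ≤ n)
    (h : CanonDecomp ρ n) (h' : CanonDecomp ρ (n + Module.finrank ℤ_[p] T))
    {γ : groupCohomology.cocycles₂ (quotRep ρ n)}
    {γ' : groupCohomology.cocycles₂ (quotRep ρ (n + Module.finrank ℤ_[p] T))} :
    Corresponds hR hU e γ γ' ↔
      idMu ρ hR hU h h' (groupCohomology.H2π _ γ) = groupCohomology.H2π _ γ' := by
  refine ⟨idMu_eq_of_corresponds he hn h h', fun hγ => ?_⟩
  obtain ⟨γ'', hγ''⟩ := exists_corresponds_right he hR hU hn γ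
  rw [idMu_eq_of_corresponds he hn h h' hγ''] at hγ
  obtain ⟨a, b, hb, h1, h2⟩ := hγ''
  exact ⟨a, b, hb, h1, hγ ▸ h2⟩

end

noncomputable section

/-! ### Homomorphisms between extensions and compatible pairs. -/

section Extensions

open scoped commutatorElement

variable {k G : Type} [CommRing k] [Group G] {A B : Rep.{0} k G}
  {f : groupCohomology.cocycles₂ A} {f' : groupCohomology.cocycles₂ B}

/-- The projection `E(f) → G`. -/
def CocycleExt.sndHom (f : groupCohomology.cocycles₂ A) : CocycleExt A f →* G where
  toFun := CocycleExt.snd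
  map_one' := rfl
  map_mul' _ _ := rfl

theorem CocycleExt.sndHom_surjective : Function.Surjective (CocycleExt.sndHom f) :=
  fun g => ⟨⟨0, g⟩, rfl⟩

/-- The inclusion `A → E(f)`. -/
def CocycleExt.embed (f : groupCohomology.cocycles₂ A) : Multiplicative A →* CocycleExt A f where
  -- Cocycles are not normalised: the identity of `E(f)` is `(-f (1, 1), 1)`, whence the shift.
  toFun a := ⟨a.toAdd - f (1, 1), 1⟩
  map_one' := by
    ext
    · exact zero_sub _
    · rfl
  map_mul' a b := by
    ext
    · change a.toAdd + b.toAdd - f (1, 1) =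
        a.toAdd - f (1, 1) + A.ρ 1 (b.toAdd - f (1, 1)) + f (1, 1)
      rw [map_one, Module.End.one_apply]
      abel
    · exact (mul_one 1).symm

open CocycleExt

theorem embed_add (a b : A) :
    embed f (.ofAdd (a + b)) = embed f (.ofAdd a) * embed f (.ofAdd b) :=
  map_mul (embed f) (.ofAdd a) (.ofAdd b)

theorem embed_neg (a : A) : embed f (.ofAdd (-a)) = (embed f (.ofAdd a))⁻¹ :=
  map_inv (embed f) (.ofAdd a)

theorem embed_injective {a b : A} (h : embed f (.ofAdd a) = embed f (.ofAdd b)) : a = b :=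
  sub_left_injective (congrArg CocycleExt.fst h)

theorem eq_embed_of_snd {x : CocycleExt A f} (hx : x.snd = 1) :
    x = embed f (.ofAdd (x.fst + f (1, 1))) := by
  ext
  · exact (add_sub_cancel_right _ _).symm
  · exact hx

theorem embed_mul (a b : A) (g : G) :
    embed f (.ofAdd a) * (⟨b, g⟩ : CocycleExt A f) = ⟨a + b, g⟩ := by
  ext
  · change a - f (1, 1) + A.ρ 1 b + f (1, g) = a + b
    rw [groupCohomology.cocycles₂_map_one_fst f g, map_one, Module.End.one_apply]
    abel
  · exact one_mul g

theorem mul_embed (x : CocycleExt A f) (a : A) :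
    x * embed f (.ofAdd a) = embed f (.ofAdd (A.ρ x.snd a)) * x := by
  obtain ⟨b, g⟩ := x
  rw [embed_mul]
  ext
  · change b + A.ρ g (a - f (1, 1)) + f (g, 1) = A.ρ g a + b
    rw [groupCohomology.cocycles₂_map_one_snd f g, map_sub]
    abel
  · exact mul_one g

theorem commutator_embed (x : CocycleExt A f) (a : A) :
    ⁅embed f (.ofAdd a), x⁆ = embed f (.ofAdd (a - A.ρ x.snd a)) := by
  rw [commutatorElement_def, sub_eq_add_neg, embed_add, embed_neg, mul_assoc, mul_assoc,
    ← mul_assoc x, ← embed_neg, mul_embed, mul_inv_cancel_right, map_neg, embed_neg]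

/-- A homomorphism `E(f) → E(f')` from compatible maps of the kernels and quotients. -/
def CocycleExt.map (σ : G →* G) (τ : A →+ B) (c : G → B)
    (hτ : ∀ g a, τ (A.ρ g a) = B.ρ (σ g) (τ a))
    (hc : ∀ g h, τ (f (g, h)) + c (g * h) = c g + B.ρ (σ g) (c h) + f' (σ g, σ h)) :
    CocycleExt A f →* CocycleExt B f' :=
  MonoidHom.mk' (fun x => ⟨τ x.fst + c x.snd, σ x.snd⟩) fun x y => by
    ext
    · change τ (x.fst + A.ρ x.snd y.fst + f (x.snd, y.snd)) + c (x.snd * y.snd) =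
        τ x.fst + c x.snd + B.ρ (σ x.snd) (τ y.fst + c y.snd) + f' (σ x.snd, σ y.snd)
      rw [map_add, add_assoc, hc, map_add, map_add, hτ]
      abel
    · exact map_mul σ _ _

theorem nonempty_mulEquiv (σ : G ≃* G) (τ : A →+ B) (hb : Function.Bijective τ) (c : G → B)
    (hτ : ∀ g a, τ (A.ρ g a) = B.ρ (σ g) (τ a))
    (hc : ∀ g h, τ (f (g, h)) + c (g * h) = c g + B.ρ (σ g) (c h) + f' (σ g, σ h)) :
    Nonempty (CocycleExt A f ≃* CocycleExt B f') := by
  refine ⟨MulEquiv.ofBijective (CocycleExt.map σ.toMonoidHom τ c hτ hc) ⟨?_, ?_⟩⟩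
  · rintro ⟨a, g⟩ ⟨b, h⟩ hab
    have h1 : g = h := σ.injective (congrArg CocycleExt.snd hab)
    subst h1
    have h2 : τ a + c g = τ b + c g := congrArg CocycleExt.fst hab
    rw [hb.1 (add_right_cancel h2)]
  · rintro ⟨b, h⟩
    obtain ⟨a, ha⟩ := hb.2 (b - c (σ.symm h))
    refine ⟨⟨a, σ.symm h⟩, ?_⟩
    ext
    · change τ a + c (σ.symm h) = b
      rw [ha, sub_add_cancel]
    · exact σ.apply_symm_apply h

theorem nonempty_mulEquiv_of_H2π_eq {f f' : groupCohomology.cocycles₂ A}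
    (h : groupCohomology.H2π A f = groupCohomology.H2π A f') :
    Nonempty (CocycleExt A f ≃* CocycleExt A f') := by
  obtain ⟨c, hc⟩ := (H2π_eq_iff f f').1 h
  exact nonempty_mulEquiv (MulEquiv.refl G) (AddMonoidHom.id A) Function.bijective_id c
    (fun _ _ => rfl) hc

theorem snd_eq_of_snd_eq (φ : CocycleExt A f →* CocycleExt B f')
    (hφ : ∀ x, x.snd = 1 → (φ x).snd = 1) {x y : CocycleExt A f} (h : x.snd = y.snd) :
    (φ x).snd = (φ y).snd := by
  have h1 : (x * y⁻¹).snd = 1 := by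
    change x.snd * y.snd⁻¹ = 1
    rw [h, mul_inv_cancel]
  have h2 := hφ _ h1
  rw [map_mul, map_inv] at h2
  exact mul_inv_eq_one.1 h2

/-- An isomorphism `E(f) → E(f')` which maps `A` onto `B` is given by a compatible pair. -/
theorem exists_compatible_pair (φ : CocycleExt A f ≃* CocycleExt B f')
    (hφ : ∀ x, x.snd = 1 → (φ x).snd = 1) (hφ' : ∀ x, x.snd = 1 → (φ.symm x).snd = 1) :
    ∃ (σ : G ≃* G) (τ : A →+ B) (c : G → B), Function.Surjective τ ∧
      (∀ g a, τ (A.ρ g a) = B.ρ (σ g) (τ a)) ∧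
      ∀ g h, τ (f (g, h)) + c (g * h) = c g + B.ρ (σ g) (c h) + f' (σ g, σ h) := by
  have h1 : ∀ {x y : CocycleExt A f}, x.snd = y.snd → (φ x).snd = (φ y).snd :=
    fun {x y} => snd_eq_of_snd_eq φ.toMonoidHom hφ
  have h2 : ∀ {x y : CocycleExt B f'}, x.snd = y.snd → (φ.symm x).snd = (φ.symm y).snd :=
    fun {x y} => snd_eq_of_snd_eq φ.symm.toMonoidHom hφ'
  -- Both `σ` and the cochain `c` are read off from the set-theoretic section `g ↦ (0, g)`.
  let σ : G ≃* G :=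
    { toFun := fun g => (φ ⟨0, g⟩).snd
      invFun := fun g => (φ.symm ⟨0, g⟩).snd
      left_inv := fun g => by
        refine (h2 (x := ⟨0, (φ ⟨0, g⟩).snd⟩) (y := φ ⟨0, g⟩) rfl).trans ?_
        rw [φ.symm_apply_apply]
      right_inv := fun g => by
        refine (h1 (x := ⟨0, (φ.symm ⟨0, g⟩).snd⟩) (y := φ.symm ⟨0, g⟩) rfl).trans ?_
        rw [φ.apply_symm_apply]
      map_mul' := fun g h => by
        refine (h1 (x := ⟨0, g * h⟩) (y := ⟨0, g⟩ * ⟨0, h⟩) rfl).trans ?_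
        rw [map_mul]
        rfl }
  have he : ∀ a, φ (embed f (.ofAdd a)) =
      embed f' (.ofAdd ((φ (embed f (.ofAdd a))).fst + f' (1, 1))) := fun a =>
    eq_embed_of_snd (hφ _ rfl)
  let τ : A →+ B := AddMonoidHom.mk' (fun a => (φ (embed f (.ofAdd a))).fst + f' (1, 1))
    fun a b => by
      apply embed_injective (f := f')
      rw [← he, embed_add, map_mul, embed_add, ← he, ← he]
  have hτe : ∀ a, φ (embed f (.ofAdd a)) = embed f' (.ofAdd (τ a)) := he
  have hs : ∀ a g, φ ⟨a, g⟩ = ⟨τ a + (φ ⟨0, g⟩).fst, σ g⟩ := fun a g => by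
    rw [← embed_mul (f := f')]
    change _ = embed f' (.ofAdd (τ a)) * φ ⟨0, g⟩
    rw [← hτe, ← map_mul, embed_mul, add_zero]
  refine ⟨σ, τ, fun g => (φ ⟨0, g⟩).fst, fun b => ?_, fun g a => ?_, fun g h => ?_⟩
  · have h3 := eq_embed_of_snd (hφ' (embed f' (.ofAdd b)) rfl)
    refine ⟨(φ.symm (embed f' (.ofAdd b))).fst + f (1, 1), embed_injective (f := f') ?_⟩
    rw [← hτe, ← h3, φ.apply_symm_apply]
  · apply embed_injective (f := f')
    rw [← hτe]
    have h3 : embed f (.ofAdd (A.ρ g a)) =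
        (⟨0, g⟩ : CocycleExt A f) * embed f (.ofAdd a) * (⟨0, g⟩ : CocycleExt A f)⁻¹ := by
      rw [mul_embed, mul_inv_cancel_right]
    rw [h3, map_mul, map_mul, map_inv, hτe, mul_embed, mul_inv_cancel_right]
    rfl
  · have h3 : (⟨0, g⟩ * ⟨0, h⟩ : CocycleExt A f) = ⟨f (g, h), g * h⟩ := by
      ext
      · change 0 + A.ρ g 0 + f (g, h) = f (g, h)
        rw [map_zero, zero_add, zero_add]
      · rfl
    have h4 := congrArg CocycleExt.fst (congrArg φ h3)
    rw [map_mul, hs (f (g, h))] at h4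
    exact h4.symm

/-- The subgroup of `E(f)` given by a submodule of `A`. -/
def CocycleExt.sub (f : groupCohomology.cocycles₂ A) (N : Submodule k A) :
    Subgroup (CocycleExt A f) :=
  (AddSubgroup.toSubgroup N.toAddSubgroup).map (embed f)

theorem embed_mem_sub {N : Submodule k A} {a : A} :
    embed f (.ofAdd a) ∈ CocycleExt.sub f N ↔ a ∈ N := by
  constructor
  · rintro ⟨b, hb, h⟩
    have := embed_injective (f := f) (a := b.toAdd) h
    exact this ▸ hb
  · exact fun h => ⟨.ofAdd a, h, rfl⟩

theorem mem_sub {N : Submodule k A} {x : CocycleExt A f} :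
    x ∈ CocycleExt.sub f N ↔ ∃ a ∈ N, x = embed f (.ofAdd a) := by
  constructor
  · rintro ⟨b, hb, rfl⟩
    exact ⟨b.toAdd, hb, rfl⟩
  · rintro ⟨a, ha, rfl⟩
    exact embed_mem_sub.2 ha

theorem sub_mono {N N' : Submodule k A} (h : N ≤ N') : CocycleExt.sub f N ≤ CocycleExt.sub f N' := by
  intro x hx
  obtain ⟨a, ha, rfl⟩ := mem_sub.1 hx
  exact embed_mem_sub.2 (h ha)

theorem mem_sub_top {x : CocycleExt A f} : x ∈ CocycleExt.sub f ⊤ ↔ x.snd = 1 := by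
  constructor
  · intro hx
    obtain ⟨a, -, rfl⟩ := mem_sub.1 hx
    rfl
  · intro hx
    rw [eq_embed_of_snd hx]
    exact embed_mem_sub.2 Submodule.mem_top

theorem sub_eq_bot_iff {N : Submodule k A} : CocycleExt.sub f N = ⊥ ↔ N = ⊥ := by
  constructor
  · intro h
    rw [eq_bot_iff]
    intro a ha
    have h1 := embed_mem_sub (f := f).2 ha
    rw [h, Subgroup.mem_bot] at h1
    exact embed_injective (h1.trans (map_one (embed f)).symm)
  · rintro rfl
    rw [eq_bot_iff]
    intro x hx
    obtain ⟨a, ha, rfl⟩ := mem_sub.1 hx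
    rw [(Submodule.mem_bot k).1 ha]
    exact map_one (embed f)

end Extensions

/-! ### Commutators of submodules of the kernel with the whole extension. -/

section Commutators

open scoped commutatorElement

variable {p : ℕ} [Fact p.Prime] {R : Type} [Group R] {A : Rep.{0} ℤ_[p] R}
  {f : groupCohomology.cocycles₂ A}

open CocycleExt

theorem commutator_sub_top (N : Submodule ℤ_[p] A) :
    ⁅CocycleExt.sub f N, (⊤ : Subgroup (CocycleExt A f))⁆ = CocycleExt.sub f (commSub A.ρ N) := by
  apply le_antisymm
  · rw [Subgroup.commutator_le]
    intro x hx y _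
    obtain ⟨a, ha, rfl⟩ := mem_sub.1 hx
    rw [commutator_embed, embed_mem_sub, ← neg_mem_iff, neg_sub]
    exact Submodule.subset_span ⟨_, a, ha, rfl⟩
  · intro x hx
    obtain ⟨a, ha, rfl⟩ := mem_sub.1 hx
    -- The commutator subgroup is only known to be closed under addition, so the scalar is carried
    -- through the induction and absorbed into `N` at the generators.
    have key : ∀ c : ℤ_[p], embed f (.ofAdd (c • a)) ∈
        ⁅CocycleExt.sub f N, (⊤ : Subgroup (CocycleExt A f))⁆ := by
      refine Submodule.span_induction (p := fun a _ => ∀ c : ℤ_[p], embed f (.ofAdd (c • a)) ∈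
        ⁅CocycleExt.sub f N, (⊤ : Subgroup (CocycleExt A f))⁆) ?_ ?_ ?_ ?_ ha
      · rintro _ ⟨g, t, ht, rfl⟩ c
        rw [← neg_sub, smul_neg, embed_neg, inv_mem_iff, smul_sub, ← map_smul]
        have h := commutator_embed (f := f) ⟨0, g⟩ (c • t)
        rw [← h]
        exact Subgroup.commutator_mem_commutator (embed_mem_sub.2 (N.smul_mem c ht))
          (Subgroup.mem_top _)
      · intro c
        rw [smul_zero]
        rw [show embed f (.ofAdd 0) = 1 from map_one (embed f)]
        exact one_mem _
      · intro a b _ _ ha hb c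
        rw [smul_add, embed_add]
        exact mul_mem (ha c) (hb c)
      · intro b a _ ha c
        rw [smul_smul]
        exact ha _
    simpa using key 1

end Commutators

end

noncomputable section

variable {p : ℕ} [Fact p.Prime] {R T : Type} [Group R] [AddCommGroup T] [Module ℤ_[p] T]
  {ρ : Representation ℤ_[p] R T}

/-! ### Consequences of uniseriality for submodules of `T`. -/

section Series

theorem commSub_map {T' : Type} [AddCommGroup T'] [Module ℤ_[p] T']
    {ρ' : Representation ℤ_[p] R T'} (π : T →ₗ[ℤ_[p]] T') (hπ : ∀ g t, π (ρ g t) = ρ' g (π t))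
    (N : Submodule ℤ_[p] T) : commSub ρ' (N.map π) = (commSub ρ N).map π := by
  rw [commSub, commSub, Submodule.map_span]
  congr 1
  ext x
  constructor
  · rintro ⟨g, _, ⟨t, ht, rfl⟩, rfl⟩
    exact ⟨ρ g t - t, ⟨g, t, ht, rfl⟩, by rw [map_sub, hπ]⟩
  · rintro ⟨_, ⟨g, t, ht, rfl⟩, rfl⟩
    exact ⟨g, π t, ⟨t, ht, rfl⟩, by rw [map_sub, hπ]⟩

theorem commSub_quotRep (n : ℕ) (N : Submodule ℤ_[p] T) :
    commSub (quotRep ρ n).ρ (N.map (lcs ρ n).mkQ) = (commSub ρ N).map (lcs ρ n).mkQ :=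
  commSub_map _ (fun _ _ => rfl) N

theorem commSub_sup (N N' : Submodule ℤ_[p] T) (hN : ∀ g, N ≤ N.comap (ρ g)) :
    commSub ρ (N ⊔ N') ≤ N ⊔ commSub ρ N' := by
  refine Submodule.span_le.2 ?_
  rintro _ ⟨g, t, ht, rfl⟩
  obtain ⟨u, hu, v, hv, rfl⟩ := Submodule.mem_sup.1 ht
  refine Submodule.mem_sup.2 ⟨ρ g u - u, N.sub_mem (hN g hu) hu, ρ g v - v,
    Submodule.subset_span ⟨g, v, hv, rfl⟩, ?_⟩
  rw [map_add]
  abel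

/-- A Nakayama argument: if `N + Tₙ = T`, then `T₁ = [R, N + Tₙ] ≤ N + Tₙ₊₁`. -/
theorem sup_lcs_eq_top {N : Submodule ℤ_[p] T} (hN : ∀ g, N ≤ N.comap (ρ g))
    (h : N ⊔ lcs ρ 1 = ⊤) (n : ℕ) : N ⊔ lcs ρ n = ⊤ := by
  induction n with
  | zero => exact sup_top_eq N
  | succ n ih =>
    rw [eq_top_iff, ← h]
    refine sup_le le_sup_left ?_
    change commSub ρ ⊤ ≤ _
    rw [← ih]
    exact commSub_sup N _ hN

theorem eq_top_of_sup_lcs_one {N : Submodule ℤ_[p] T} (hN : ∀ g, N ≤ N.comap (ρ g)) {n : ℕ}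
    (hn : lcs ρ n ≤ N) (h : N ⊔ lcs ρ 1 = ⊤) : N = ⊤ := by
  rw [← sup_lcs_eq_top hN h n, sup_eq_left.2 hn]

variable [Finite R] [Module.Free ℤ_[p] T] [Module.Finite ℤ_[p] T]

theorem pow_smul_mem_lcs (hR : IsPGroup p R) (hU : IsUniserial ρ) (j : ℕ) (t : T) :
    p ^ j • t ∈ lcs ρ (j * Module.finrank ℤ_[p] T) := by
  induction j with
  | zero =>
    rw [zero_mul]
    exact Submodule.mem_top
  | succ j ih =>
    rw [pow_succ', mul_smul, add_mul, one_mul]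
    exact nsmul_mem_lcs ρ hR hU ih

theorem pow_smul_mem_lcs_self [Nontrivial T] (hR : IsPGroup p R) (hU : IsUniserial ρ) (n : ℕ)
    (t : T) : p ^ n • t ∈ lcs ρ n :=
  lcs_antitone ρ (Nat.le_mul_of_pos_right n (Module.finrank_pos (R := ℤ_[p]) (M := T)))
    (pow_smul_mem_lcs hR hU n t)

theorem lcs_ne_bot [Nontrivial T] (hR : IsPGroup p R) (hU : IsUniserial ρ) (n : ℕ) :
    lcs ρ n ≠ ⊥ := by
  intro h
  obtain ⟨t, ht⟩ := exists_ne (0 : T)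
  have h1 := pow_smul_mem_lcs_self hR hU n t
  rw [h, Submodule.mem_bot] at h1
  exact ht (lattice_smul_eq_zero p _ (pow_ne_zero _ (Fact.out : p.Prime).ne_zero) _ h1)

theorem card_quotient_lcs [Nontrivial T] (hR : IsPGroup p R) (hU : IsUniserial ρ) (n : ℕ) :
    Nat.card (T ⧸ lcs ρ n) = p ^ n :=
  index_lcs ρ hU n fun i _ => lcs_ne_bot hR hU i

theorem lcs_le_lcs_iff [Nontrivial T] (hR : IsPGroup p R) (hU : IsUniserial ρ) {m n : ℕ} :
    lcs ρ m ≤ lcs ρ n ↔ n ≤ m := by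
  refine ⟨fun h => ?_, fun h => lcs_antitone ρ h⟩
  have h1 := AddSubgroup.index_dvd_of_le (H := (lcs ρ m).toAddSubgroup)
    (K := (lcs ρ n).toAddSubgroup) h
  rw [index_lcs ρ hU _ fun i _ => lcs_ne_bot hR hU i,
    index_lcs ρ hU _ fun i _ => lcs_ne_bot hR hU i] at h1
  exact (Nat.pow_dvd_pow_iff_le_right (Fact.out : p.Prime).one_lt).1 h1

/-- `T₁` has prime index, hence is maximal. -/
theorem sup_lcs_one_eq [Nontrivial T] (hR : IsPGroup p R) (hU : IsUniserial ρ)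
    (N : Submodule ℤ_[p] T) : N ≤ lcs ρ 1 ∨ N ⊔ lcs ρ 1 = ⊤ := by
  have h1 := AddSubgroup.relIndex_mul_index (H := (lcs ρ 1).toAddSubgroup)
    (K := (N ⊔ lcs ρ 1).toAddSubgroup) (le_sup_right (a := N))
  rw [index_lcs ρ hU _ fun i _ => lcs_ne_bot hR hU i, pow_one] at h1
  rcases (Nat.dvd_prime (Fact.out : p.Prime)).1 ⟨_, h1.symm⟩ with h2 | h2
  · exact Or.inl (le_sup_left.trans (AddSubgroup.relIndex_eq_one.1 h2))
  · right
    rw [h2] at h1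
    have h3 : (N ⊔ lcs ρ 1).toAddSubgroup.index = 1 :=
      Nat.eq_of_mul_eq_mul_left (Fact.out : p.Prime).pos (h1.trans (mul_one p).symm)
    rw [AddSubgroup.index_eq_one] at h3
    exact Submodule.toAddSubgroup_injective h3

/-- Since `p ^ n` kills `Aₙ`, scalars act through residues modulo `p ^ n`. Hence subgroups of `Aₙ`
are submodules and additive maps are linear. -/
theorem exists_smul_eq_nsmul [Nontrivial T] (hR : IsPGroup p R) (hU : IsUniserial ρ) (n : ℕ)
    (z : ℤ_[p]) : ∃ m : ℕ, ∀ x : T ⧸ lcs ρ n, z • x = m • x := by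
  refine ⟨PadicInt.appr z n, fun x => ?_⟩
  obtain ⟨w, hw⟩ := Ideal.mem_span_singleton'.1 (PadicInt.appr_spec n z)
  rw [← sub_eq_zero, ← Nat.cast_smul_eq_nsmul ℤ_[p], ← sub_smul, ← hw, mul_smul]
  obtain ⟨t, rfl⟩ := (lcs ρ n).mkQ_surjective x
  have h : (p : ℤ_[p]) ^ n • (lcs ρ n).mkQ t = 0 := by
    rw [← map_smul, ← Nat.cast_pow, Nat.cast_smul_eq_nsmul]
    exact (Submodule.Quotient.mk_eq_zero _).2 (pow_smul_mem_lcs_self hR hU n t)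
  rw [h, smul_zero]

end Series

/-! ### Coclass `r` read off from the lower central series of the extension. -/

section Coclass

open CocycleExt

theorem card_cocycleExt {A : Rep.{0} ℤ_[p] R} (f : groupCohomology.cocycles₂ A) :
    Nat.card (CocycleExt A f) = Nat.card A * Nat.card R := by
  rw [← Nat.card_prod]
  exact Nat.card_congr ⟨fun x => (x.fst, x.snd), fun x => ⟨x.1, x.2⟩, fun _ => rfl, fun _ => rfl⟩

theorem lowerCentralSeries_le_sub_top {A : Rep.{0} ℤ_[p] R} (f : groupCohomology.cocycles₂ A)
    {c : ℕ} (hc : Subgroup.lowerCentralSeries (⊤ : Subgroup R) c = ⊥) :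
    Subgroup.lowerCentralSeries (⊤ : Subgroup (CocycleExt A f)) c ≤ CocycleExt.sub f ⊤ := by
  intro x hx
  have h := Subgroup.mem_map_of_mem (sndHom f) hx
  rw [Subgroup.map_lowerCentralSeries, Subgroup.map_top_of_surjective _ sndHom_surjective, hc]
    at h
  exact mem_sub_top.2 h

theorem lowerCentralSeries_add {n : ℕ} (f : groupCohomology.cocycles₂ (quotRep ρ n)) {c : ℕ}
    (h : Subgroup.lowerCentralSeries (⊤ : Subgroup (CocycleExt _ f)) c = CocycleExt.sub f ⊤)
    (i : ℕ) : Subgroup.lowerCentralSeries (⊤ : Subgroup (CocycleExt _ f)) (c + i) =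
      CocycleExt.sub f ((lcs ρ i).map (lcs ρ n).mkQ) := by
  induction i with
  | zero =>
    rw [add_zero, h, lcs, Submodule.map_top, Submodule.range_mkQ]
  | succ i ih =>
    rw [← add_assoc, Subgroup.lowerCentralSeries_succ, ih, commutator_sub_top]
    exact congrArg _ (commSub_quotRep n _)

theorem lowerCentralSeries_add_le {n : ℕ} (f : groupCohomology.cocycles₂ (quotRep ρ n)) {c : ℕ}
    (h : Subgroup.lowerCentralSeries (⊤ : Subgroup (CocycleExt _ f)) c ≤
      CocycleExt.sub f ((lcs ρ 1).map (lcs ρ n).mkQ))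
    (i : ℕ) : Subgroup.lowerCentralSeries (⊤ : Subgroup (CocycleExt _ f)) (c + i) ≤
      CocycleExt.sub f ((lcs ρ (i + 1)).map (lcs ρ n).mkQ) := by
  induction i with
  | zero => exact h
  | succ i ih =>
    rw [← add_assoc, Subgroup.lowerCentralSeries_succ]
    refine (Subgroup.commutator_mono ih le_rfl).trans ?_
    rw [commutator_sub_top]
    exact sub_mono (commSub_quotRep n _).le

theorem map_mkQ_eq_bot_iff {m n : ℕ} :
    (lcs ρ m).map (lcs ρ n).mkQ = ⊥ ↔ lcs ρ m ≤ lcs ρ n := by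
  rw [← le_bot_iff, Submodule.map_le_iff_le_comap, Submodule.comap_bot, Submodule.ker_mkQ]

variable [Finite R] [Module.Free ℤ_[p] T] [Module.Finite ℤ_[p] T] [Nontrivial T]

/-- This term lies in `Aₙ`, and its preimage in `T` is an invariant submodule containing `Tₙ`. Such
a submodule lies in the maximal `T₁` or is all of `T`. -/
theorem lowerCentralSeries_eq_or_le (hR : IsPGroup p R) (hU : IsUniserial ρ) {n : ℕ}
    (f : groupCohomology.cocycles₂ (quotRep ρ n)) {c : ℕ}
    (hc : Subgroup.lowerCentralSeries (⊤ : Subgroup R) c = ⊥) :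
    Subgroup.lowerCentralSeries (⊤ : Subgroup (CocycleExt _ f)) c = CocycleExt.sub f ⊤ ∨
    Subgroup.lowerCentralSeries (⊤ : Subgroup (CocycleExt _ f)) c ≤
      CocycleExt.sub f ((lcs ρ 1).map (lcs ρ n).mkQ) := by
  set L := Subgroup.lowerCentralSeries (⊤ : Subgroup (CocycleExt _ f)) c with hL
  have hle : L ≤ CocycleExt.sub f ⊤ := lowerCentralSeries_le_sub_top f hc
  let N : Submodule ℤ_[p] T :=
    { carrier := {t | embed f (.ofAdd ((lcs ρ n).mkQ t)) ∈ L}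
      zero_mem' := by
        change embed f (.ofAdd ((lcs ρ n).mkQ 0)) ∈ L
        rw [map_zero]
        exact (map_one (embed f)).symm ▸ one_mem L
      add_mem' := fun {a b} ha hb => by
        change embed f (.ofAdd ((lcs ρ n).mkQ (a + b))) ∈ L
        rw [map_add]
        exact (embed_add (f := f) _ _).symm ▸ mul_mem ha hb
      smul_mem' := fun z a ha => by
        obtain ⟨m, hm⟩ := exists_smul_eq_nsmul hR hU n z
        change embed f (.ofAdd ((lcs ρ n).mkQ (z • a))) ∈ L
        rw [map_smul, hm]
        exact (map_pow (embed f) (.ofAdd ((lcs ρ n).mkQ a)) m).symm ▸ pow_mem ha m }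
  have hmem : ∀ {t}, t ∈ N ↔ embed f (.ofAdd ((lcs ρ n).mkQ t)) ∈ L := Iff.rfl
  have hN : ∀ g, N ≤ N.comap (ρ g) := by
    intro g t ht
    have h1 := mul_embed (f := f) ⟨0, g⟩ ((lcs ρ n).mkQ t)
    rw [← mul_inv_eq_iff_eq_mul] at h1
    have h2 : L.Normal := inferInstance
    have h3 := h2.conj_mem _ ht ⟨0, g⟩
    rw [h1] at h3
    exact h3
  have hn : lcs ρ n ≤ N := by
    intro t ht
    have h0 : (lcs ρ n).mkQ t = 0 := (Submodule.Quotient.mk_eq_zero _).2 ht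
    rw [hmem, h0]
    exact (map_one (embed f)).symm ▸ one_mem L
  have hLN : ∀ x ∈ L, ∃ t ∈ N, x = embed f (.ofAdd ((lcs ρ n).mkQ t)) := by
    intro x hx
    obtain ⟨a, -, rfl⟩ := mem_sub.1 (hle hx)
    obtain ⟨t, rfl⟩ := (lcs ρ n).mkQ_surjective a
    exact ⟨t, hx, rfl⟩
  rcases sup_lcs_one_eq hR hU N with h | h
  · right
    intro x hx
    obtain ⟨t, ht, rfl⟩ := hLN x hx
    exact embed_mem_sub.2 ⟨t, h ht, rfl⟩
  · left
    refine le_antisymm hle fun x hx => ?_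
    obtain ⟨a, -, rfl⟩ := mem_sub.1 hx
    obtain ⟨t, rfl⟩ := (lcs ρ n).mkQ_surjective a
    have ht : t ∈ N := by
      rw [eq_top_of_sup_lcs_one hN hn h]
      exact Submodule.mem_top
    exact ht

variable {r : ℕ}

theorem hasCoclass_iff_nilpotencyClass (hR : IsPGroup p R) (hU : IsUniserial ρ)
    (hr : HasCoclass p R r) {n : ℕ} (f : groupCohomology.cocycles₂ (quotRep ρ n)) :
    HasCoclass p (CocycleExt _ f) r ↔
      Group.nilpotencyClass (CocycleExt _ f) = Group.nilpotencyClass R + n := by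
  have h : Nat.card (CocycleExt _ f) = p ^ (Group.nilpotencyClass R + n + r) := by
    rw [card_cocycleExt, hr]
    change Nat.card (T ⧸ lcs ρ n) * _ = _
    rw [card_quotient_lcs hR hU, ← pow_add]
    congr 1
    omega
  rw [HasCoclass, h, Nat.pow_right_inj (Fact.out : p.Prime).two_le]
  omega

theorem isNilpotent_cocycleExt (hR : IsPGroup p R) (hU : IsUniserial ρ) {n : ℕ}
    (f : groupCohomology.cocycles₂ (quotRep ρ n)) : Group.IsNilpotent (CocycleExt _ f) := by
  obtain ⟨e, he⟩ := IsPGroup.iff_card.1 hR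
  have h : Nat.card (CocycleExt _ f) = p ^ (n + e) := by
    rw [card_cocycleExt, he, pow_add]
    exact congrArg (· * _) (card_quotient_lcs hR hU n)
  have : Finite (CocycleExt _ f) := Nat.finite_of_card_ne_zero
    (h ▸ pow_ne_zero _ (Fact.out : p.Prime).ne_zero)
  exact (IsPGroup.of_card h).isNilpotent

/-- By orders, coclass `r` means class `c + n`, where `c` is the class of `R`. If the `c`-th term is
`Aₙ`, the series continues with `Tᵢ / Tₙ` and needs exactly `n` more steps; otherwise that term lies
in `T₁ / Tₙ` and one step is saved. -/
theorem hasCoclass_iff_eq_sub_top (hR : IsPGroup p R) (hU : IsUniserial ρ)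
    (hr : HasCoclass p R r) {n : ℕ} (hn : n ≠ 0) (f : groupCohomology.cocycles₂ (quotRep ρ n)) :
    HasCoclass p (CocycleExt _ f) r ↔
      Subgroup.lowerCentralSeries (⊤ : Subgroup (CocycleExt _ f)) (Group.nilpotencyClass R) =
        CocycleExt.sub f ⊤ := by
  have := isNilpotent_cocycleExt hR hU f
  have := hR.isNilpotent
  have hc := Subgroup.lowerCentralSeries_nilpotencyClass (G := R)
  rw [hasCoclass_iff_nilpotencyClass hR hU hr]
  constructor
  · intro h
    refine (lowerCentralSeries_eq_or_le hR hU f hc).resolve_right fun hle => ?_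
    have h1 := lowerCentralSeries_add_le f hle (n - 1)
    rw [Nat.sub_add_cancel (Nat.one_le_iff_ne_zero.2 hn),
      sub_eq_bot_iff.2 (map_mkQ_eq_bot_iff.2 le_rfl), le_bot_iff,
      Subgroup.lowerCentralSeries_eq_bot_iff_nilpotencyClass_le] at h1
    omega
  · intro h
    refine eq_of_forall_ge_iff fun j => ?_
    rw [← Subgroup.lowerCentralSeries_eq_bot_iff_nilpotencyClass_le]
    rcases lt_or_ge j (Group.nilpotencyClass R) with hj | hj
    -- Vanishing before step `c` would force `Aₙ = 0`, contrary to `n ≠ 0`.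
    · refine ⟨fun hb => ?_, fun hb => by omega⟩
      have h0 := lowerCentralSeries_add f h 0
      have h1 : Subgroup.lowerCentralSeries (⊤ : Subgroup (CocycleExt _ f))
          (Group.nilpotencyClass R + 0) ≤ ⊥ :=
        hb ▸ Subgroup.lowerCentralSeries_antitone _ (by omega)
      rw [h0, le_bot_iff, sub_eq_bot_iff, map_mkQ_eq_bot_iff, lcs_le_lcs_iff hR hU] at h1
      omega
    · obtain ⟨i, rfl⟩ := Nat.exists_eq_add_of_le hj
      rw [lowerCentralSeries_add f h i, sub_eq_bot_iff, map_mkQ_eq_bot_iff, lcs_le_lcs_iff hR hU]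
      omega

theorem not_le_sub_of_eq (hR : IsPGroup p R) (hU : IsUniserial ρ) {n : ℕ} (hn : n ≠ 0)
    (f : groupCohomology.cocycles₂ (quotRep ρ n)) :
    ¬ CocycleExt.sub f ⊤ ≤ CocycleExt.sub f ((lcs ρ 1).map (lcs ρ n).mkQ) := by
  intro h
  have h1 : lcs ρ 0 ≤ lcs ρ 1 := by
    intro t _
    have h2 := embed_mem_sub.1 (h (embed_mem_sub.2 (Submodule.mem_top (x := (lcs ρ n).mkQ t))))
    obtain ⟨s, hs, hst⟩ := h2
    have h3 : t - s ∈ lcs ρ n := (Submodule.Quotient.eq _).1 hst.symm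
    have h4 := add_mem (lcs_antitone ρ (Nat.one_le_iff_ne_zero.2 hn) h3) hs
    rwa [sub_add_cancel] at h4
  rw [lcs_le_lcs_iff hR hU] at h1
  omega

/-- The projection `Aₙ → A₁`. -/
def quotOne (ρ : Representation ℤ_[p] R T) {n : ℕ} (hn : n ≠ 0) : quotRep ρ n ⟶ quotRep ρ 1 :=
  Rep.ofHom ⟨Submodule.mapQ _ _ LinearMap.id
    (lcs_antitone ρ (Nat.one_le_iff_ne_zero.2 hn)), fun g => by
      ext t
      rfl⟩

/-- Whether `E(γ)` has coclass `r` only depends on the image of `γ` in `Z²(R, A₁)`. -/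
theorem hasCoclass_iff (hR : IsPGroup p R) (hU : IsUniserial ρ)
    (hr : HasCoclass p R r) {n : ℕ} (hn : n ≠ 0) (f : groupCohomology.cocycles₂ (quotRep ρ n)) :
    HasCoclass p (CocycleExt _ f) r ↔
      Subgroup.lowerCentralSeries (⊤ : Subgroup (CocycleExt _ (mapZ2 (quotOne ρ hn) f)))
        (Group.nilpotencyClass R) ≠ ⊥ := by
  have := hR.isNilpotent
  have hc := Subgroup.lowerCentralSeries_nilpotencyClass (G := R)
  -- The kernel of this surjection is `T₁ / Tₙ`, so the `c`-th term has nontrivial image exactly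
  -- when it is not contained in `T₁ / Tₙ`.
  let q : CocycleExt _ f →* CocycleExt _ (mapZ2 (quotOne ρ hn) f) :=
    CocycleExt.map (MonoidHom.id R) (quotOne ρ hn).hom.toLinearMap.toAddMonoidHom 0
      (fun g a => Rep.hom_comm_apply (quotOne ρ hn) g a)
      (fun g h => by
        change (quotOne ρ hn).hom (f (g, h)) + 0 = 0 + (quotRep ρ 1).ρ g 0 + _
        rw [map_zero, add_zero, zero_add, zero_add]
        rfl)
  have hqe : ∀ t, q (embed f (.ofAdd ((lcs ρ n).mkQ t))) =
      embed _ (.ofAdd ((lcs ρ 1).mkQ t)) := by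
    intro t
    ext
    · change (quotOne ρ hn).hom ((lcs ρ n).mkQ t - f (1, 1)) + 0 = (lcs ρ 1).mkQ t -
        (quotOne ρ hn).hom (f (1, 1))
      rw [map_sub, add_zero]
      rfl
    · rfl
  have hq : Function.Surjective q := by
    rintro ⟨a, g⟩
    obtain ⟨t, rfl⟩ := (lcs ρ 1).mkQ_surjective a
    refine ⟨⟨(lcs ρ n).mkQ t, g⟩, ?_⟩
    ext
    · exact add_zero _
    · rfl
  have hq0 : ∀ t, q (embed f (.ofAdd ((lcs ρ n).mkQ t))) = 1 ↔ t ∈ lcs ρ 1 := by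
    intro t
    rw [hqe, ← map_one (embed _)]
    constructor
    · exact fun h => (Submodule.Quotient.mk_eq_zero _).1 (embed_injective h)
    · exact fun h => congrArg _ (congrArg Multiplicative.ofAdd
        ((Submodule.Quotient.mk_eq_zero _).2 h))
  have hmap := Subgroup.map_lowerCentralSeries (⊤ : Subgroup (CocycleExt _ f)) q
    (Group.nilpotencyClass R)
  rw [Subgroup.map_top_of_surjective q hq] at hmap
  rw [hasCoclass_iff_eq_sub_top hR hU hr hn, ← hmap, Ne, Subgroup.map_eq_bot_iff]
  constructor
  · intro h hle
    refine not_le_sub_of_eq hR hU hn f (h ▸ fun x hx => ?_)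
    obtain ⟨a, -, rfl⟩ := mem_sub.1 (lowerCentralSeries_le_sub_top f hc hx)
    obtain ⟨t, rfl⟩ := (lcs ρ n).mkQ_surjective a
    exact embed_mem_sub.2 ⟨t, (hq0 t).1 (hle hx), rfl⟩
  · intro h
    refine (lowerCentralSeries_eq_or_le hR hU f hc).resolve_right fun hle => h fun x hx => ?_
    obtain ⟨_, ⟨t, ht, rfl⟩, rfl⟩ := mem_sub.1 (hle hx)
    exact (hq0 t).2 ht

end Coclass

end

noncomputable section

/-! ### Action of compatible pairs on cocycles. -/

section Push

variable {k G : Type} [CommRing k] [Group G] {A B : Rep.{0} k G}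

/-- The image of a 2-cocycle under a compatible pair `(σ, τ)`. -/
def pushZ2 (σ : G ≃* G) (τ : A →ₗ[k] B) (hτ : ∀ g a, τ (A.ρ g a) = B.ρ (σ g) (τ a))
    (f : groupCohomology.cocycles₂ A) : groupCohomology.cocycles₂ B :=
  ⟨fun x => τ (f (σ.symm x.1, σ.symm x.2)), by
    rw [groupCohomology.mem_cocycles₂_iff]
    intro g h j
    have h1 := (groupCohomology.mem_cocycles₂_iff f.1).1 f.2 (σ.symm g) (σ.symm h) (σ.symm j)
    have h2 := congrArg τ h1
    rw [map_add, map_add, hτ, σ.apply_symm_apply, ← map_mul, ← map_mul] at h2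
    exact h2⟩

variable {σ : G ≃* G} {τ : A →ₗ[k] B} {hτ : ∀ g a, τ (A.ρ g a) = B.ρ (σ g) (τ a)}

theorem pushZ2_apply (f : groupCohomology.cocycles₂ A) (x : G × G) :
    pushZ2 σ τ hτ f x = τ (f (σ.symm x.1, σ.symm x.2)) := rfl

theorem H2π_pushZ2_congr {f f' : groupCohomology.cocycles₂ A}
    (h : groupCohomology.H2π A f = groupCohomology.H2π A f') :
    groupCohomology.H2π B (pushZ2 σ τ hτ f) = groupCohomology.H2π B (pushZ2 σ τ hτ f') := by
  obtain ⟨c, hc⟩ := (H2π_eq_iff f f').1 h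
  refine (H2π_eq_iff _ _).2 ⟨fun g => τ (c (σ.symm g)), fun g h => ?_⟩
  have h1 := congrArg τ (hc (σ.symm g) (σ.symm h))
  rw [map_add, map_add, map_add, hτ, σ.apply_symm_apply, ← map_mul] at h1
  exact h1

theorem H2π_pushZ2_eq_iff {f : groupCohomology.cocycles₂ A} {f' : groupCohomology.cocycles₂ B} :
    groupCohomology.H2π B (pushZ2 σ τ hτ f) = groupCohomology.H2π B f' ↔
      ∃ c : G → B, ∀ g h, τ (f (g, h)) + c (g * h) = c g + B.ρ (σ g) (c h) + f' (σ g, σ h) := by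
  rw [H2π_eq_iff]
  constructor
  · rintro ⟨c, hc⟩
    refine ⟨fun g => c (σ g), fun g h => ?_⟩
    have h1 := hc (σ g) (σ h)
    rw [pushZ2_apply, σ.symm_apply_apply, σ.symm_apply_apply, ← map_mul] at h1
    exact h1
  · rintro ⟨c, hc⟩
    refine ⟨fun g => c (σ.symm g), fun g h => ?_⟩
    have h1 := hc (σ.symm g) (σ.symm h)
    rw [σ.apply_symm_apply, σ.apply_symm_apply, ← map_mul] at h1
    exact h1

theorem nonempty_mulEquiv_of_pushZ2 (hb : Function.Bijective τ) {f : groupCohomology.cocycles₂ A}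
    {f' : groupCohomology.cocycles₂ B}
    (h : groupCohomology.H2π B (pushZ2 σ τ hτ f) = groupCohomology.H2π B f') :
    Nonempty (CocycleExt A f ≃* CocycleExt B f') := by
  obtain ⟨c, hc⟩ := H2π_pushZ2_eq_iff.1 h
  exact nonempty_mulEquiv σ τ.toAddMonoidHom hb c hτ hc

end Push

/-! ### Compatible pairs split into a lattice part and a torsion part. -/

variable {p : ℕ} [Fact p.Prime] {R T : Type} [Group R] [AddCommGroup T] [Module ℤ_[p] T]

/-- A `σ`-equivariant map `T → Aₙ`, written as the sum of a map which lifts to `T` and of a map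
whose values are killed by `p ^ e`. -/
structure LiftedPair (ρ : Representation ℤ_[p] R T) (e n : ℕ) (σ : R ≃* R) (τ : T →ₗ[ℤ_[p]] T)
    (θ : T →ₗ[ℤ_[p]] quotRep ρ n) : Prop where
  map_lift : ∀ g t, τ (ρ g t) = ρ (σ g) (τ t)
  map_tors : ∀ g t, θ (ρ g t) = (quotRep ρ n).ρ (σ g) (θ t)
  mem : ∀ t, θ t ∈ (divLat ρ (p ^ e) n).map (lcs ρ n).mkQ

variable {ρ : Representation ℤ_[p] R T}

theorem map_mem_lcs {σ : R ≃* R} {τ : T →ₗ[ℤ_[p]] T} (h : ∀ g t, τ (ρ g t) = ρ (σ g) (τ t))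
    (n : ℕ) : ∀ t ∈ lcs ρ n, τ t ∈ lcs ρ n := by
  induction n with
  | zero => exact fun _ _ => Submodule.mem_top
  | succ n ih =>
    refine Submodule.span_le (p := (lcs ρ (n + 1)).comap τ).2 ?_
    rintro _ ⟨g, t, ht, rfl⟩
    exact Submodule.subset_span ⟨σ g, τ t, ih t ht, by rw [map_sub, h]⟩

theorem pow_smul_eq_zero_of_mem {e n : ℕ} {x : quotRep ρ n}
    (hx : x ∈ (divLat ρ (p ^ e) n).map (lcs ρ n).mkQ) : p ^ e • x = 0 := by
  obtain ⟨t, ht, rfl⟩ := hx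
  rw [← map_nsmul]
  exact (Submodule.Quotient.mk_eq_zero _).2 (mem_divLat.1 ht)

/-- A trivial group would give `T₁ = 0`, while no term of the series vanishes. -/
theorem pos_of_card_eq_pow [Finite R] [Module.Free ℤ_[p] T] [Module.Finite ℤ_[p] T] [Nontrivial T] {e : ℕ}
    (hR : IsPGroup p R) (hU : IsUniserial ρ)
    (he : Nat.card R = p ^ e) :
    e ≠ 0 := by
  rintro rfl
  rw [pow_zero, Nat.card_eq_one_iff_unique] at he
  have := he.1
  refine lcs_ne_bot hR hU 1 (Submodule.span_eq_bot.2 ?_)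
  rintro _ ⟨g, t, -, rfl⟩
  rw [Subsingleton.elim g 1, map_one, Module.End.one_apply, sub_self]

namespace LiftedPair

variable {e n : ℕ} {σ : R ≃* R} {τ : T →ₗ[ℤ_[p]] T} {θ : T →ₗ[ℤ_[p]] quotRep ρ n}

theorem tors_pow_smul (h : LiftedPair ρ e n σ τ θ) (t : T) : θ (p ^ e • t) = 0 := by
  rw [map_nsmul, pow_smul_eq_zero_of_mem (h.mem t)]

/-- The values of `θ` are killed by `p ^ e`, and `D ≤ p ^ e T`. Thus `θ` descends to `Aₙ` and does
not see the torsion part of a cocycle. -/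
theorem tors_eq_zero [Module.Free ℤ_[p] T] (h : LiftedPair ρ e n σ τ θ)
    (hn : ∀ t ∈ lcs ρ n, ∃ s, t = p ^ (2 * e) • s) {t : T} (ht : t ∈ divLat ρ (p ^ e) n) :
    θ t = 0 := by
  obtain ⟨s, rfl⟩ := exists_eq_pow_smul_of_mem_divLat hn ht
  exact h.tors_pow_smul s

variable [Module.Free ℤ_[p] T]

/-- The map `Aₙ → Aₙ` induced by `τ + θ`. -/
def quot (h : LiftedPair ρ e n σ τ θ) (hn : ∀ t ∈ lcs ρ n, ∃ s, t = p ^ (2 * e) • s) :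
    quotRep ρ n →ₗ[ℤ_[p]] quotRep ρ n :=
  (lcs ρ n).liftQ ((lcs ρ n).mkQ ∘ₗ τ + θ) fun t ht => by
    change (lcs ρ n).mkQ (τ t) + θ t = 0
    rw [h.tors_eq_zero hn (lcs_le_divLat _ n ht), add_zero]
    exact (Submodule.Quotient.mk_eq_zero _).2 (map_mem_lcs h.map_lift n t ht)

variable {h : LiftedPair ρ e n σ τ θ} {hn : ∀ t ∈ lcs ρ n, ∃ s, t = p ^ (2 * e) • s}

theorem quot_mkQ (t : T) : h.quot hn ((lcs ρ n).mkQ t) = (lcs ρ n).mkQ (τ t) + θ t := rfl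

theorem quot_map (g : R) (x : quotRep ρ n) :
    h.quot hn ((quotRep ρ n).ρ g x) = (quotRep ρ n).ρ (σ g) (h.quot hn x) := by
  obtain ⟨t, rfl⟩ := (lcs ρ n).mkQ_surjective x
  change h.quot hn ((lcs ρ n).mkQ (ρ g t)) = _
  rw [quot_mkQ, quot_mkQ, h.map_lift, h.map_tors, map_add]
  rfl

theorem quot_mem {x : quotRep ρ n} (hx : x ∈ (divLat ρ (p ^ e) n).map (lcs ρ n).mkQ) :
    h.quot hn x ∈ (divLat ρ (p ^ e) n).map (lcs ρ n).mkQ := by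
  obtain ⟨t, ht, rfl⟩ := hx
  rw [quot_mkQ, h.tors_eq_zero hn ht, add_zero]
  refine Submodule.mem_map_of_mem (mem_divLat.2 ?_)
  rw [← map_nsmul]
  exact map_mem_lcs h.map_lift n _ (mem_divLat.1 ht)

variable [Finite R] [Module.Finite ℤ_[p] T]

theorem divLat_le_lcs_one [Nontrivial T] (hR : IsPGroup p R) (hU : IsUniserial ρ)
    (he : Nat.card R = p ^ e) (hn : ∀ t ∈ lcs ρ n, ∃ s, t = p ^ (2 * e) • s) :
    divLat ρ (p ^ e) n ≤ lcs ρ 1 := by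
  intro t ht
  obtain ⟨s, rfl⟩ := exists_eq_pow_smul_of_mem_divLat hn ht
  exact lcs_antitone ρ (Nat.one_le_iff_ne_zero.2 (pos_of_card_eq_pow hR hU he))
    (pow_smul_mem_lcs_self hR hU e s)

/-- Modulo `T₁` the map `θ` is invisible because `D ≤ T₁`, and surjectivity modulo `T₁` suffices.
The criterion involves only `τ`, so it is the same for `n` and `n + d`. -/
theorem quot_surjective_iff [Nontrivial T] (hR : IsPGroup p R) (hU : IsUniserial ρ)
    (he : Nat.card R = p ^ e) :
    Function.Surjective (h.quot hn) ↔ LinearMap.range τ ⊔ lcs ρ 1 = ⊤ := by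
  have hM := divLat_le_lcs_one hR hU he hn
  have hn1 : lcs ρ n ≤ lcs ρ 1 := (lcs_le_divLat _ n).trans hM
  constructor
  · intro hs
    rw [eq_top_iff]
    intro t _
    obtain ⟨x, hx⟩ := hs ((lcs ρ n).mkQ t)
    obtain ⟨s, rfl⟩ := (lcs ρ n).mkQ_surjective x
    obtain ⟨u, hu, hus⟩ := h.mem s
    rw [quot_mkQ, ← hus, ← map_add] at hx
    have h1 : τ s + u - t ∈ lcs ρ n := (Submodule.Quotient.eq _).1 hx
    refine Submodule.mem_sup.2 ⟨τ s, ⟨s, rfl⟩, u - (τ s + u - t),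
      sub_mem (hM hu) (hn1 h1), ?_⟩
    abel
  · intro hs
    have key : (LinearMap.range (h.quot hn)).comap (lcs ρ n).mkQ = ⊤ := by
      refine eq_top_of_sup_lcs_one (ρ := ρ) (n := n) ?_ ?_ ?_
      · rintro g t ⟨x, hx⟩
        refine ⟨(quotRep ρ n).ρ (σ.symm g) x, ?_⟩
        rw [quot_map, σ.apply_symm_apply, hx]
        rfl
      · intro t ht
        refine ⟨0, ?_⟩
        rw [map_zero]
        exact ((Submodule.Quotient.mk_eq_zero _).2 ht).symm
      · rw [eq_top_iff, ← hs]
        refine sup_le ?_ le_sup_right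
        rintro _ ⟨s, rfl⟩
        obtain ⟨u, hu, hus⟩ := h.mem s
        refine Submodule.mem_sup.2 ⟨τ s + u, ⟨(lcs ρ n).mkQ s, ?_⟩, -u, neg_mem (hM hu), by abel⟩
        rw [quot_mkQ, ← hus, map_add]
    intro x
    obtain ⟨t, rfl⟩ := (lcs ρ n).mkQ_surjective x
    have ht : t ∈ (LinearMap.range (h.quot hn)).comap (lcs ρ n).mkQ :=
      key ▸ Submodule.mem_top
    exact ht

theorem quot_bijective [Nontrivial T] (hR : IsPGroup p R) (hU : IsUniserial ρ)
    (hs : Function.Surjective (h.quot hn)) : Function.Bijective (h.quot hn) := by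
  have : Finite (quotRep ρ n) := Nat.finite_of_card_ne_zero (by
    change Nat.card (T ⧸ lcs ρ n) ≠ 0
    rw [card_quotient_lcs hR hU]
    exact pow_ne_zero _ (Fact.out : p.Prime).ne_zero)
  exact ⟨Finite.injective_iff_surjective.2 hs, hs⟩

/-- The image of a cocycle under the compatible pair given by `σ` and `τ + θ`. -/
def push (h : LiftedPair ρ e n σ τ θ) (hn : ∀ t ∈ lcs ρ n, ∃ s, t = p ^ (2 * e) • s)
    (γ : groupCohomology.cocycles₂ (quotRep ρ n)) : groupCohomology.cocycles₂ (quotRep ρ n) :=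
  pushZ2 σ (h.quot hn) quot_map γ

variable {hR : IsPGroup p R} {hU : IsUniserial ρ}

/-- With `γ = α + β`, the image under `τ + θ` is `τ α + (θ α + τ β)`, since `θ β = 0`. Under `τ + p
θ`, the image of `α + p β` is `τ α + p (θ α + τ β)`. -/
theorem corresponds_push
    {hn' : ∀ t ∈ lcs ρ (n + Module.finrank ℤ_[p] T), ∃ s, t = p ^ (2 * e) • s}
    (h' : LiftedPair ρ e (n + Module.finrank ℤ_[p] T) σ τ
      ((quotMulP hR hU n).hom.toLinearMap ∘ₗ θ))
    {γ : groupCohomology.cocycles₂ (quotRep ρ n)}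
    {γ' : groupCohomology.cocycles₂ (quotRep ρ (n + Module.finrank ℤ_[p] T))}
    (hγ : Corresponds hR hU e γ γ') :
    Corresponds hR hU e (h.push hn γ) (h'.push hn' γ') := by
  obtain ⟨a, b, hb, h1, h2⟩ := hγ
  refine ⟨pushZ2 σ τ h.map_lift a, pushZ2 σ θ h.map_tors a + h.push hn b, fun y => ?_, ?_, ?_⟩
  · exact add_mem (h.mem _) (quot_mem (hb _))
  · refine (H2π_pushZ2_congr h1).trans (congrArg _ ?_)
    refine groupCohomology.cocycles₂_ext fun g j => ?_
    change h.quot hn ((lcs ρ n).mkQ (a (σ.symm g, σ.symm j)) + b (σ.symm g, σ.symm j)) =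
      (lcs ρ n).mkQ (τ (a (σ.symm g, σ.symm j))) + (θ (a (σ.symm g, σ.symm j)) +
        h.quot hn (b (σ.symm g, σ.symm j)))
    rw [map_add, quot_mkQ, add_assoc]
  · refine (H2π_pushZ2_congr h2).trans (congrArg _ ?_)
    refine groupCohomology.cocycles₂_ext fun g j => ?_
    change h'.quot hn' ((lcs ρ _).mkQ (a (σ.symm g, σ.symm j)) +
      (quotMulP hR hU n).hom (b (σ.symm g, σ.symm j))) = (lcs ρ _).mkQ (τ (a (σ.symm g, σ.symm j))) +
        (quotMulP hR hU n).hom (θ (a (σ.symm g, σ.symm j)) + h.quot hn (b (σ.symm g, σ.symm j)))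
    obtain ⟨t, ht, hbt⟩ := hb (σ.symm g, σ.symm j)
    rw [map_add, quot_mkQ, add_assoc, map_add, ← hbt, quotMulP_mkQ, quot_mkQ, quot_mkQ,
      h.tors_eq_zero hn ht, add_zero, quotMulP_mkQ]
    obtain ⟨s, rfl⟩ := exists_eq_pow_smul_of_mem_divLat hn ht
    rw [smul_comm p, h'.tors_pow_smul, add_zero, ← smul_comm p, map_nsmul τ p]
    rfl

end LiftedPair

/-! ### Lifting a compatible pair by averaging. -/

section Lift

variable [Finite R] [Module.Free ℤ_[p] T] {e n : ℕ}

/-- The twisted sum of the conjugates of a linear lift `τ₀` is equivariant and congruent to `p ^ e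
τ₀` modulo `Tₙ ≤ p^(2e) T`. Hence it is `p ^ e τ'`, and `τ₀ - τ'` takes values in `D`. -/
theorem exists_liftedPair (he : Nat.card R = p ^ e)
    (hn : ∀ t ∈ lcs ρ n, ∃ s, t = p ^ (2 * e) • s) (σ : R ≃* R)
    (τ : quotRep ρ n →ₗ[ℤ_[p]] quotRep ρ n)
    (hτ : ∀ g x, τ ((quotRep ρ n).ρ g x) = (quotRep ρ n).ρ (σ g) (τ x)) :
    ∃ (τ' : T →ₗ[ℤ_[p]] T) (θ : T →ₗ[ℤ_[p]] quotRep ρ n) (h : LiftedPair ρ e n σ τ' θ),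
      τ = h.quot hn := by
  have := Fintype.ofFinite R
  have hp : p ^ e ≠ 0 := pow_ne_zero _ (Fact.out : p.Prime).ne_zero
  obtain ⟨τ₀, hτ₀⟩ := Module.projective_lifting_property (lcs ρ n).mkQ (τ ∘ₗ (lcs ρ n).mkQ)
    (lcs ρ n).mkQ_surjective
  have hτ₀ : ∀ t, (lcs ρ n).mkQ (τ₀ t) = τ ((lcs ρ n).mkQ t) := LinearMap.congr_fun hτ₀
  let F : R → T →ₗ[ℤ_[p]] T := fun g => ρ (σ g)⁻¹ ∘ₗ τ₀ ∘ₗ ρ g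
  have hF : ∀ g t, (lcs ρ n).mkQ (F g t) = τ ((lcs ρ n).mkQ t) := by
    intro g t
    change (quotRep ρ n).ρ (σ g)⁻¹ ((lcs ρ n).mkQ (τ₀ (ρ g t))) = _
    rw [hτ₀]
    change (quotRep ρ n).ρ (σ g)⁻¹ (τ ((quotRep ρ n).ρ g ((lcs ρ n).mkQ t))) = _
    rw [hτ, ← Module.End.mul_apply, ← map_mul, inv_mul_cancel, map_one, Module.End.one_apply]
  let φ : T →ₗ[ℤ_[p]] T := ∑ g, F g
  have hφ : ∀ t, φ t - p ^ e • τ₀ t ∈ lcs ρ n := by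
    intro t
    refine (Submodule.Quotient.mk_eq_zero _).1 ?_
    change (lcs ρ n).mkQ (φ t - p ^ e • τ₀ t) = 0
    rw [LinearMap.sum_apply, map_sub, map_sum, Finset.sum_congr rfl fun g _ => hF g t,
      Finset.sum_const, Finset.card_univ, ← Nat.card_eq_fintype_card, he, map_nsmul, hτ₀, sub_self]
  have hφσ : ∀ g t, φ (ρ g t) = ρ (σ g) (φ t) := by
    intro g t
    rw [LinearMap.sum_apply, LinearMap.sum_apply, map_sum,
      ← Equiv.sum_comp (Equiv.mulRight g) fun x => ρ (σ g) (F x t)]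
    refine Finset.sum_congr rfl fun x _ => ?_
    change ρ (σ x)⁻¹ (τ₀ (ρ x (ρ g t))) = ρ (σ g) (ρ (σ (x * g))⁻¹ (τ₀ (ρ (x * g) t)))
    rw [← Module.End.mul_apply (ρ x), ← map_mul, ← Module.End.mul_apply (ρ (σ g)), ← map_mul,
      map_mul σ, mul_inv_rev, mul_inv_cancel_left]
  -- Twisting the target by `σ` turns `σ`-equivariance into a morphism of representations, so that
  -- division by `p ^ e` applies.
  let B : Rep.{0} ℤ_[p] R := Rep.of (ρ.comp σ.toMonoidHom)
  let φ' : latticeRep ρ ⟶ B := Rep.ofHom ⟨φ, fun g => LinearMap.ext (hφσ g)⟩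
  obtain ⟨ψ, hψ⟩ := exists_nsmul_hom φ' (p ^ e) (fun b hb => lattice_smul_eq_zero p _ hp b hb)
    fun t => by
      obtain ⟨s, hs⟩ := hn _ (hφ t)
      refine ⟨τ₀ t + p ^ e • s, ?_⟩
      change φ t = _
      rw [sub_eq_iff_eq_add] at hs
      rw [hs, smul_add, smul_smul, ← pow_add, ← two_mul, add_comm]
  let τ' : T →ₗ[ℤ_[p]] T := ψ.hom.toLinearMap
  have hψ' : ∀ t, φ t = p ^ e • τ' t := hψ
  have hlift : ∀ g t, τ' (ρ g t) = ρ (σ g) (τ' t) := Rep.hom_comm_apply ψ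
  let θ : T →ₗ[ℤ_[p]] quotRep ρ n := τ ∘ₗ (lcs ρ n).mkQ - (lcs ρ n).mkQ ∘ₗ τ'
  have hθ : ∀ t, θ t = τ ((lcs ρ n).mkQ t) - (lcs ρ n).mkQ (τ' t) := fun _ => rfl
  have h : LiftedPair ρ e n σ τ' θ := by
    refine ⟨hlift, fun g t => ?_, fun t => ⟨τ₀ t - τ' t, mem_divLat.2 ?_, ?_⟩⟩
    · rw [hθ, hθ, hlift, map_sub, ← hτ]
      rfl
    · rw [smul_sub, ← hψ', ← neg_sub]
      exact neg_mem (hφ t)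
    · rw [map_sub, hτ₀, hθ]
  refine ⟨τ', θ, h, LinearMap.ext fun x => ?_⟩
  obtain ⟨t, rfl⟩ := (lcs ρ n).mkQ_surjective x
  rw [LiftedPair.quot_mkQ, hθ, add_sub_cancel]

end Lift

end

noncomputable section

theorem exists_quotient_equiv {X Y : Type} (sX : Setoid X) (sY : Setoid Y) (r : X → Y → Prop)
    (hl : ∀ x, ∃ y, r x y) (hr : ∀ y, ∃ x, r x y)
    (h : ∀ x y x' y', r x y → r x' y' → (sX x x' ↔ sY y y')) :
    ∃ Φ : Quotient sX ≃ Quotient sY, ∀ x y, r x y → Φ (Quotient.mk sX x) = Quotient.mk sY y := by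
  choose F hF using hl
  let Φ : Quotient sX → Quotient sY := Quotient.map F fun a b hab =>
    (h _ _ _ _ (hF a) (hF b)).1 hab
  have hΦ : ∀ x y, r x y → Φ (Quotient.mk sX x) = Quotient.mk sY y := fun x y hxy =>
    Quotient.sound ((h _ _ _ _ (hF x) hxy).1 (sX.refl x))
  refine ⟨Equiv.ofBijective Φ ⟨?_, ?_⟩, hΦ⟩
  · rintro ⟨x⟩ ⟨x'⟩ hxx'
    exact Quotient.sound ((h _ _ _ _ (hF x) (hF x')).2 (Quotient.exact hxx'))
  · rintro ⟨y⟩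
    obtain ⟨x, hx⟩ := hr y
    exact ⟨Quotient.mk sX x, hΦ x y hx⟩

variable {p : ℕ} [Fact p.Prime] {R T : Type} [Group R] [AddCommGroup T] [Module ℤ_[p] T]
  {ρ : Representation ℤ_[p] R T} [Finite R] [Module.Free ℤ_[p] T] [Module.Finite ℤ_[p] T]
  {e n r : ℕ}

/-! ### Corresponding cocycles: same coclass condition, same isomorphisms. -/

section Coclass

variable {hR : IsPGroup p R} {hU : IsUniserial ρ} [Nontrivial T]

theorem quotOne_eq_zero (hR : IsPGroup p R) (hU : IsUniserial ρ) (he : Nat.card R = p ^ e)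
    (hn : 2 * e * Module.finrank ℤ_[p] T ≤ n) (hn0 : n ≠ 0) {x : quotRep ρ n}
    (hx : x ∈ (divLat ρ (p ^ e) n).map (lcs ρ n).mkQ) : (quotOne ρ hn0).hom x = 0 := by
  obtain ⟨t, ht, rfl⟩ := hx
  exact (Submodule.Quotient.mk_eq_zero _).2
    (LiftedPair.divLat_le_lcs_one hR hU he (lcs_le_pow_smul hR hU hn) ht)

theorem mapZ2_quotOne_eq_zero (hR : IsPGroup p R) (hU : IsUniserial ρ) (he : Nat.card R = p ^ e)
    (hn : 2 * e * Module.finrank ℤ_[p] T ≤ n) (hn0 : n ≠ 0)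
    {b : groupCohomology.cocycles₂ (quotRep ρ n)}
    (hb : ∀ y, b y ∈ (divLat ρ (p ^ e) n).map (lcs ρ n).mkQ) : mapZ2 (quotOne ρ hn0) b = 0 :=
  groupCohomology.cocycles₂_ext fun g h => quotOne_eq_zero hR hU he hn hn0 (hb (g, h))

theorem hasCoclass_iff_of_corresponds (he : Nat.card R = p ^ e) (hr : HasCoclass p R r)
    (hn : 2 * e * Module.finrank ℤ_[p] T ≤ n) (hn0 : n ≠ 0)
    {γ : groupCohomology.cocycles₂ (quotRep ρ n)}
    {γ' : groupCohomology.cocycles₂ (quotRep ρ (n + Module.finrank ℤ_[p] T))}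
    (h : Corresponds hR hU e γ γ') :
    HasCoclass p (CocycleExt _ γ) r ↔ HasCoclass p (CocycleExt _ γ') r := by
  obtain ⟨a, b, hb, h1, h2⟩ := h
  have hn' : n + Module.finrank ℤ_[p] T ≠ 0 := by omega
  have h3 := H2π_mapZ2_congr (quotOne ρ hn0) h1
  have h4 := H2π_mapZ2_congr (quotOne ρ hn') h2
  rw [mapZ2_add, mapZ2_quotOne_eq_zero hR hU he hn hn0 hb, add_zero] at h3
  rw [mapZ2_add, mapZ2_quotOne_eq_zero hR hU he (hn.trans (Nat.le_add_right _ _)) hn'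
    (b := mapZ2 (quotMulP hR hU n) b) (fun y => quotMulP_mem (hR := hR) (hU := hU) (hb y)), add_zero] at h4
  have h5 : groupCohomology.H2π _ (mapZ2 (quotOne ρ hn0) γ) =
    groupCohomology.H2π _ (mapZ2 (quotOne ρ hn') γ') := h3.trans h4.symm
  obtain ⟨ε⟩ := nonempty_mulEquiv_of_H2π_eq h5
  rw [hasCoclass_iff hR hU hr hn0, hasCoclass_iff hR hU hr hn', not_iff_not]
  have h6 := Subgroup.map_lowerCentralSeries (⊤ : Subgroup _) ε.toMonoidHom
    (Group.nilpotencyClass R)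
  rw [Subgroup.map_top_of_surjective _ ε.surjective] at h6
  rw [← h6]
  exact (Subgroup.map_eq_bot_iff_of_injective _ ε.injective).symm

/-- Coclass `r` identifies the kernel with a term of the lower central series, which every
isomorphism preserves. -/
theorem exists_pair_of_mulEquiv (hR : IsPGroup p R) (hU : IsUniserial ρ)
    (he : Nat.card R = p ^ e) (hr : HasCoclass p R r)
    (hn : ∀ t ∈ lcs ρ n, ∃ s, t = p ^ (2 * e) • s) (hn0 : n ≠ 0)
    {γ δ : groupCohomology.cocycles₂ (quotRep ρ n)}
    (hγ : HasCoclass p (CocycleExt _ γ) r) (hδ : HasCoclass p (CocycleExt _ δ) r)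
    (ε : CocycleExt _ γ ≃* CocycleExt _ δ) :
    ∃ (σ : R ≃* R) (τ : T →ₗ[ℤ_[p]] T) (θ : T →ₗ[ℤ_[p]] quotRep ρ n)
      (h : LiftedPair ρ e n σ τ θ), Function.Surjective (h.quot hn) ∧
        groupCohomology.H2π _ (h.push hn γ) = groupCohomology.H2π _ δ := by
  have key : ∀ {γ δ : groupCohomology.cocycles₂ (quotRep ρ n)}
      (_ : HasCoclass p (CocycleExt _ γ) r) (_ : HasCoclass p (CocycleExt _ δ) r)
      (ε : CocycleExt _ γ ≃* CocycleExt _ δ) (x : CocycleExt _ γ), x.snd = 1 → (ε x).snd = 1 := by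
    intro γ δ hγ hδ ε x hx
    rw [hasCoclass_iff_eq_sub_top hR hU hr hn0] at hγ hδ
    rw [← mem_sub_top, ← hγ] at hx
    have h := Subgroup.mem_map_of_mem ε.toMonoidHom hx
    rw [Subgroup.map_lowerCentralSeries, Subgroup.map_top_of_surjective _ ε.surjective, hδ] at h
    exact mem_sub_top.1 h
  obtain ⟨σ, τ, c, hs, hτ, hc⟩ :=
    exists_compatible_pair ε (key hγ hδ ε) (key hδ hγ ε.symm)
  let τl : quotRep ρ n →ₗ[ℤ_[p]] quotRep ρ n :=
    { τ with
      map_smul' := fun z x => by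
        obtain ⟨m, hm⟩ := exists_smul_eq_nsmul hR hU n z
        change τ (z • x) = z • τ x
        rw [hm, hm, map_nsmul] }
  obtain ⟨τ', θ, h, hh⟩ := exists_liftedPair he hn σ τl hτ
  have hτh : ∀ x, h.quot hn x = τ x := fun x => (LinearMap.congr_fun hh x).symm
  refine ⟨σ, τ', θ, h, fun x => ?_, H2π_pushZ2_eq_iff.2 ⟨c, fun g j => ?_⟩⟩
  · obtain ⟨y, hy⟩ := hs x
    exact ⟨y, (hτh y).trans hy⟩
  · rw [hτh]
    exact hc g j

omit [Nontrivial T] in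
-- Multiplication by `p` is an isomorphism from `Tₙ` to `Tₙ₊d`.
theorem mu_injective : Function.Injective (mu ρ hR hU n) := by
  have : Mono (mulP ρ hR hU n) := (Rep.mono_iff_injective _).2 fun x y h => by
    have h1 : (p : ℤ_[p]) • (x : T) = (p : ℤ_[p]) • (y : T) := congrArg Subtype.val h
    rw [← sub_eq_zero, ← smul_sub, Nat.cast_smul_eq_nsmul] at h1
    exact Subtype.ext (sub_eq_zero.1
      (lattice_smul_eq_zero p _ (Fact.out : p.Prime).ne_zero _ h1))
  have : Epi (mulP ρ hR hU n) := (Rep.epi_iff_surjective _).2 fun x => by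
    obtain ⟨s, hs, h⟩ := exists_smul_of_mem_lcs ρ hR hU n x.1 x.2
    refine ⟨⟨s, hs⟩, Subtype.ext ?_⟩
    rw [h, ← Nat.cast_smul_eq_nsmul ℤ_[p]]
    rfl
  have : IsIso (mulP ρ hR hU n) := isIso_of_mono_of_epi _
  intro x y hxy
  have h := congrArg (mapH (inv (mulP ρ hR hU n)) 3) hxy
  change mapH _ 3 (mapH (mulP ρ hR hU n) 3 x) = mapH _ 3 (mapH (mulP ρ hR hU n) 3 y) at h
  rwa [← mapH_comp, ← mapH_comp, IsIso.hom_inv_id, mapH_id, mapH_id] at h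

omit [Nontrivial T] in
theorem idMu_injective (h : CanonDecomp ρ n)
    (h' : CanonDecomp ρ (n + Module.finrank ℤ_[p] T)) :
    Function.Injective (idMu ρ hR hU h h') :=
  (canonEquiv ρ h').injective.comp
    ((Function.injective_id.prodMap mu_injective).comp (canonEquiv ρ h).symm.injective)

theorem nonempty_mulEquiv_iff (he : Nat.card R = p ^ e) (hr : HasCoclass p R r)
    (hn : 2 * e * Module.finrank ℤ_[p] T ≤ n) (hn0 : n ≠ 0)
    {γ δ : groupCohomology.cocycles₂ (quotRep ρ n)}
    {γ' δ' : groupCohomology.cocycles₂ (quotRep ρ (n + Module.finrank ℤ_[p] T))}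
    (hγ : Corresponds hR hU e γ γ') (hδ : Corresponds hR hU e δ δ')
    (hγr : HasCoclass p (CocycleExt _ γ) r) (hδr : HasCoclass p (CocycleExt _ δ) r) :
    Nonempty (CocycleExt _ γ ≃* CocycleExt _ δ) ↔
      Nonempty (CocycleExt _ γ' ≃* CocycleExt _ δ') := by
  have hn0' : n + Module.finrank ℤ_[p] T ≠ 0 := by omega
  have hk := lcs_le_pow_smul hR hU hn
  have hk' := lcs_le_pow_smul hR hU (hn.trans (Nat.le_add_right _ (Module.finrank ℤ_[p] T)))
  have hD := canonDecomp he hk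
  have hD' := canonDecomp he hk'
  have hγr' := (hasCoclass_iff_of_corresponds he hr hn hn0 hγ).1 hγr
  have hδr' := (hasCoclass_iff_of_corresponds he hr hn hn0 hδ).1 hδr
  rw [corresponds_iff he hn hD hD'] at hδ
  constructor
  · rintro ⟨ε⟩
    obtain ⟨σ, τ, θ, h, hs, hpush⟩ := exists_pair_of_mulEquiv hR hU he hr hk hn0 hγr hδr ε
    have h' : LiftedPair ρ e (n + Module.finrank ℤ_[p] T) σ τ
        ((quotMulP hR hU n).hom.toLinearMap ∘ₗ θ) :=
      ⟨h.map_lift, fun g t => by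
        rw [LinearMap.comp_apply, h.map_tors]
        exact Rep.hom_comm_apply (quotMulP hR hU n) _ _, fun t => quotMulP_mem (hR := hR) (hU := hU) (h.mem t)⟩
    have hc := (corresponds_iff he hn hD hD').1 (h.corresponds_push (hn := hk) (hn' := hk') h' hγ)
    rw [hpush, hδ] at hc
    rw [LiftedPair.quot_surjective_iff hR hU he] at hs
    exact nonempty_mulEquiv_of_pushZ2 (LiftedPair.quot_bijective hR hU
      ((LiftedPair.quot_surjective_iff (h := h') (hn := hk') hR hU he).2 hs)) hc.symm
  · rintro ⟨ε⟩
    obtain ⟨σ, τ, θ', h', hs, hpush⟩ :=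
      exists_pair_of_mulEquiv hR hU he hr hk' hn0' hγr' hδr' ε
    have hinj := quotMulP_injective (hR := hR) (hU := hU) (n := n)
    -- The torsion part on `Aₙ₊d` is divided by `p`; injectivity of `Aₙ → Aₙ₊d` makes the quotient
    -- linear.
    obtain ⟨θ, hθ, hθ'⟩ : ∃ θ : T →ₗ[ℤ_[p]] quotRep ρ n,
        (∀ t, θ t ∈ (divLat ρ (p ^ e) n).map (lcs ρ n).mkQ) ∧
          θ' = (quotMulP hR hU n).hom.toLinearMap ∘ₗ θ := by
      choose F hF hF' using fun t => exists_quotMulP_eq (hR := hR) (hU := hU) hn (h'.mem t)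
      exact ⟨{
        toFun := F
        map_add' := fun x y => hinj (by rw [map_add, hF', hF', hF', map_add])
        map_smul' := fun z x => hinj (by rw [RingHom.id_apply, map_smul, hF', hF', map_smul]) },
        hF, LinearMap.ext fun t => (hF' t).symm⟩
    subst hθ'
    have h : LiftedPair ρ e n σ τ θ :=
      ⟨h'.map_lift, fun g t => hinj ((h'.map_tors g t).trans
        (Rep.hom_comm_apply (quotMulP hR hU n) _ _).symm), hθ⟩
    have hc := (corresponds_iff he hn hD hD').1 (h.corresponds_push (hn := hk) (hn' := hk') h' hγ)
    rw [hpush, ← hδ] at hc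
    rw [LiftedPair.quot_surjective_iff hR hU he] at hs
    exact nonempty_mulEquiv_of_pushZ2 (LiftedPair.quot_bijective hR hU
      ((LiftedPair.quot_surjective_iff (h := h) (hn := hk) hR hU he).2 hs))
      (idMu_injective hD hD' hc)

end Coclass

/-! ### The case `T = 0`, where `n` may be zero, and the final bijection. -/

section Subsingleton

variable [Subsingleton T]

omit [Finite R] [Module.Free ℤ_[p] T] [Module.Finite ℤ_[p] T] in
theorem hasCoclass_of_subsingleton (hr : HasCoclass p R r) (hR : Group.IsNilpotent R)
    (γ : groupCohomology.cocycles₂ (quotRep ρ n)) : HasCoclass p (CocycleExt _ γ) r := by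
  have : Subsingleton (T ⧸ lcs ρ n) := (lcs ρ n).mkQ_surjective.subsingleton
  let ε : CocycleExt _ γ ≃* R := MulEquiv.ofBijective (CocycleExt.sndHom γ)
    ⟨fun x y h => CocycleExt.ext (Subsingleton.elim (α := T ⧸ lcs ρ n) _ _) h,
      CocycleExt.sndHom_surjective⟩
  have : Group.IsNilpotent (CocycleExt _ γ) := Group.nilpotent_of_mulEquiv ε.symm
  have h1 := Group.nilpotencyClass_le_of_surjective ε.toMonoidHom ε.surjective
  have h2 := Group.nilpotencyClass_le_of_surjective ε.symm.toMonoidHom ε.symm.surjective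
  rw [HasCoclass, Nat.card_congr ε.toEquiv, hr, le_antisymm h2 h1]

omit [Finite R] [Module.Free ℤ_[p] T] [Module.Finite ℤ_[p] T] in
theorem cocycles₂_eq_of_subsingleton (γ δ : groupCohomology.cocycles₂ (quotRep ρ n)) : γ = δ := by
  have : Subsingleton (T ⧸ lcs ρ n) := (lcs ρ n).mkQ_surjective.subsingleton
  exact groupCohomology.cocycles₂_ext fun g h => Subsingleton.elim (α := T ⧸ lcs ρ n) _ _

end Subsingleton

theorem exists_extClass_equiv (hR : IsPGroup p R) (hU : IsUniserial ρ)
    (he : Nat.card R = p ^ e) (hr : HasCoclass p R r)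
    (hn : 2 * e * Module.finrank ℤ_[p] T ≤ n) (hD : CanonDecomp ρ n)
    (hD' : CanonDecomp ρ (n + Module.finrank ℤ_[p] T)) :
    ∃ Φ : ExtClass ρ n r ≃ ExtClass ρ (n + Module.finrank ℤ_[p] T) r,
      ∀ (γ : groupCohomology.cocycles₂ (quotRep ρ n))
        (γ' : groupCohomology.cocycles₂ (quotRep ρ (n + Module.finrank ℤ_[p] T))),
        idMu ρ hR hU hD hD' (groupCohomology.H2π (quotRep ρ n) γ) =
          groupCohomology.H2π (quotRep ρ (n + Module.finrank ℤ_[p] T)) γ' →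
        ∀ hγ : HasCoclass p (CocycleExt (quotRep ρ n) γ) r,
          ∃ hγ' : HasCoclass p
            (CocycleExt (quotRep ρ (n + Module.finrank ℤ_[p] T)) γ') r,
            Φ (ExtClass.mk ρ γ hγ) = ExtClass.mk ρ γ' hγ' := by
  have hcc : ∀ {γ : groupCohomology.cocycles₂ (quotRep ρ n)}
      {γ' : groupCohomology.cocycles₂ (quotRep ρ (n + Module.finrank ℤ_[p] T))},
      Corresponds hR hU e γ γ' →
      (HasCoclass p (CocycleExt _ γ) r ↔ HasCoclass p (CocycleExt _ γ') r) := by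
    intro γ γ' h
    rcases subsingleton_or_nontrivial T with hT | hT
    · have := hR.isNilpotent
      exact iff_of_true (hasCoclass_of_subsingleton hr this γ)
        (hasCoclass_of_subsingleton hr this γ')
    · have hn0 : n ≠ 0 := by
        have h1 := pos_of_card_eq_pow hR hU he
        have h2 : 0 < Module.finrank ℤ_[p] T := Module.finrank_pos
        have h3 : 0 < 2 * e * Module.finrank ℤ_[p] T := by positivity
        omega
      exact hasCoclass_iff_of_corresponds he hr hn hn0 h
  -- Correspondence is a relation, total on both sides, that matches isomorphism with isomorphism;
  -- no choice of representing cocycles enters `Φ`.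
  obtain ⟨Φ, hΦ⟩ := exists_quotient_equiv (isoSetoid ρ n r)
    (isoSetoid ρ (n + Module.finrank ℤ_[p] T) r)
    (fun γ γ' => Corresponds hR hU e γ.1 γ'.1)
    (fun γ => by
      obtain ⟨γ', h⟩ := exists_corresponds_right he hR hU hn γ.1
      exact ⟨⟨γ', (hcc h).1 γ.2⟩, h⟩)
    (fun γ' => by
      obtain ⟨γ, h⟩ := exists_corresponds_left he hR hU hn γ'.1
      exact ⟨⟨γ, (hcc h).2 γ'.2⟩, h⟩)
    (fun γ γ' δ δ' hγ hδ => by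
      change Nonempty _ ↔ Nonempty _
      rcases subsingleton_or_nontrivial T with hT | hT
      · exact iff_of_true
          (nonempty_mulEquiv_of_H2π_eq (congrArg _ (cocycles₂_eq_of_subsingleton _ _)))
          (nonempty_mulEquiv_of_H2π_eq (congrArg _ (cocycles₂_eq_of_subsingleton _ _)))
      · have hn0 : n ≠ 0 := by
          have h1 := pos_of_card_eq_pow hR hU he
          have h2 : 0 < Module.finrank ℤ_[p] T := Module.finrank_pos
          have h3 : 0 < 2 * e * Module.finrank ℤ_[p] T := by positivity
          omega
        exact nonempty_mulEquiv_iff he hr hn hn0 hγ hδ γ.2 δ.2)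
  refine ⟨Φ, fun γ γ' h hγ => ?_⟩
  have hc := (corresponds_iff he hn hD hD').2 h
  exact ⟨(hcc hc).1 hγ, hΦ ⟨γ, hγ⟩ ⟨γ', (hcc hc).1 hγ⟩ hc⟩

end

end UniserialExt

theorem mainTheorem7 (p : ℕ) [Fact p.Prime] (R T : Type) [Group R] [Finite R]
    [AddCommGroup T] [Module ℤ_[p] T] [Module.Free ℤ_[p] T] [Module.Finite ℤ_[p] T]
    (ρ : Representation ℤ_[p] R T) (hR : IsPGroup p R) (hU : UniserialExt.IsUniserial ρ)
    (r : ℕ) (hr : UniserialExt.HasCoclass p R r) :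
    ∃ m : ℕ, m ≤ 2 * Module.finrank ℤ_[p] T * Nat.log p (Nat.card R) ∧
      ∃ hm : ∀ n : ℕ, m ≤ n → UniserialExt.CanonDecomp ρ n,
        ∀ t₀ : T, Submodule.span ℤ_[p] {t₀} ⊔ UniserialExt.lcs ρ 1 = ⊤ →
        ∀ (v : ℕ) (hv : m ≤ v * Module.finrank ℤ_[p] T),
          (∀ n : ℕ, UniserialExt.expB ρ t₀ n *
            max (UniserialExt.expA ρ n) (UniserialExt.expB ρ t₀ n) ≤ p ^ v) →
        ∀ (n : ℕ) (hn : v * Module.finrank ℤ_[p] T ≤ n),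
          ∃ Φ : UniserialExt.ExtClass ρ n r ≃
              UniserialExt.ExtClass ρ (n + Module.finrank ℤ_[p] T) r,
            ∀ (γ : groupCohomology.cocycles₂ (UniserialExt.quotRep ρ n))
              (γ' : groupCohomology.cocycles₂
                (UniserialExt.quotRep ρ (n + Module.finrank ℤ_[p] T))),
              UniserialExt.idMu ρ hR hU (hm n (hv.trans hn))
                  (hm _ ((hv.trans hn).trans (Nat.le_add_right _ _)))
                  (groupCohomology.H2π (UniserialExt.quotRep ρ n) γ) =
                groupCohomology.H2π
                  (UniserialExt.quotRep ρ (n + Module.finrank ℤ_[p] T)) γ' →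
              ∀ hγ : UniserialExt.HasCoclass p
                (UniserialExt.CocycleExt (UniserialExt.quotRep ρ n) γ) r,
                ∃ hγ' : UniserialExt.HasCoclass p
                  (UniserialExt.CocycleExt
                    (UniserialExt.quotRep ρ (n + Module.finrank ℤ_[p] T)) γ') r,
                  Φ (UniserialExt.ExtClass.mk ρ γ hγ) = UniserialExt.ExtClass.mk ρ γ' hγ' := by
  obtain ⟨e, he⟩ := IsPGroup.iff_card.1 hR
  have hm : ∀ n, 2 * e * Module.finrank ℤ_[p] T ≤ n → UniserialExt.CanonDecomp ρ n :=
    fun n hn => UniserialExt.canonDecomp he (UniserialExt.lcs_le_pow_smul hR hU hn)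
  refine ⟨2 * e * Module.finrank ℤ_[p] T, ?_, hm, fun _ _ v hv _ n hn =>
    UniserialExt.exists_extClass_equiv hR hU he hr (hv.trans hn) _ _⟩
  rw [he, Nat.log_pow (Fact.out : p.Prime).one_lt, Nat.mul_right_comm]
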